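/- Let $d\ge 1$, and let $(\Omega,\mathcal A,\mathbb P)$ be a probability space with a measurable, $\mathbb P$-preserving action of the translation group $\mathbb R^d$. Let $\Phi$ be a random locally finite complex measure on $\mathbb R^d$ that is invariant (in particular stationary), i.e. $\Phi(g\omega,gB)=\Phi(\omega,B)$ for all $\omega\in\Omega$, all bounded Borel sets $B$ and all translations $g$. Let $|\Phi|$ denote its total variation measure, and assume that $\Phi$ is locally absolutely square-integrable, i.e. $\mathbb E[|\Phi|(B)^2]<\infty$ for all bounded Borel sets $B$. Let $K$ be an invariant random transport kernel on $\mathbb R^d$, i.e. a kernel from $\Omega\times\mathbb R^d$ to $\mathbb R^d$ whose values $K_x=K(\cdot,x,\cdot)$ are complex measures of finite total variation, with $K(g\omega,gx,gB)=K(\omega,x,B)$ for all $\omega\in\Omega$, $x\in\mathbb R^d$, Borel sets $B$ and translations $g$. Put $K^*(x,B):=K(x,B+x)$. Assume that at least one of the following two conditions holds. (a) There is a strongly log-dominating function $\rho$, i.e. a nondecreasing $\rho:[0,\infty)\to[0,\infty)$ with $\int_0^\infty \frac{dr}{r\rho(r)+1}<\infty$, such that the random measure $$\Psi_{d,\rho}(dy):=\Big(\int\sqrt{\|x\|^d\rho(\|x\|)+1}\;|K^*|(y,dx)\Big)\,|\Phi|(dy)$$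 satisfies $\mathbb E[\Psi_{d,\rho}(B)^2]<\infty$ for all bounded Borel sets $B$. (b) $K$ has uniformly bounded total variation, i.e. there is a constant $b<\infty$ with $|K|(\omega,x,\mathbb R^d)\le b$ for all $\omega$ and $x$; $K$ and $\Phi$ are independent, in the sense that for some $\sigma$-field $\mathcal G\subseteq\mathcal A$ independent of $\sigma(\Phi)$ the maps $(\omega,x)\mapsto K(\omega,x,B)$, $B$ Borel, are measurable with respect to $\mathcal G\otimes\mathcal B(\mathbb R^d)$; and $\mathbb E\big[\int\|x\|^d\,|K_0|(dx)\big]<\infty$. Then the measure $|K||\Phi|=\int |K|(x,\cdot)\,|\Phi|(dx)$ is almost surely locally finite, so that the destination $K\Phi(B)=\int K(x,B)\,\Phi(dx)$ is a well-defined random complex measure (set to $0$ on the exceptional null event), and $K\Phi$ is locally absolutely square-integrable: $\mathbb E[|K\Phi|(B)^2]<\infty$ for all bounded Borel sets $B$. -/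

import Mathlib

open MeasureTheory ProbabilityTheory Set
open scoped ENNReal NNReal Pointwise

noncomputable section

namespace Transport

/-- `ℝ^d` with the Euclidean norm. -/
abbrev E (d : ℕ) : Type := EuclideanSpace ℝ (Fin d)

/-! ### Locally finite complex measures

A locally absolutely finite complex measure on `X` is in general only defined on the bounded
Borel sets. It is represented by a set function `μ : Set X → ℂ`, of which only the values on
bounded Borel sets are ever used. -/

/-- `μ` is of the form `μ₁ - μ₂ + i (μ₃ - μ₄)` on bounded Borel sets, with locally finite
measures `μ₁, μ₂, μ₃, μ₄`. -/
def IsLocComplexMeasure {X : Type*} [PseudoMetricSpace X] [MeasurableSpace X]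
    (μ : Set X → ℂ) : Prop :=
  ∃ μ₁ μ₂ μ₃ μ₄ : Measure X,
    IsLocallyFiniteMeasure μ₁ ∧ IsLocallyFiniteMeasure μ₂ ∧
    IsLocallyFiniteMeasure μ₃ ∧ IsLocallyFiniteMeasure μ₄ ∧
    ∀ B : Set X, Bornology.IsBounded B → MeasurableSet B →
      μ B = ((μ₁.real B - μ₂.real B : ℝ) : ℂ) + Complex.I * ((μ₃.real B - μ₄.real B : ℝ) : ℂ)

/-- The total variation measure `|μ|`: the smallest measure `ν` such that `|μ(B)| ≤ ν(B)` for all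
bounded Borel sets `B`. -/
def locVariation {X : Type*} [PseudoMetricSpace X] [MeasurableSpace X]
    (μ : Set X → ℂ) : Measure X :=
  sInf {ν : Measure X | ∀ B : Set X, Bornology.IsBounded B → MeasurableSet B → ‖μ B‖ₑ ≤ ν B}

/-- The positive part (in the Jordan decomposition) of a locally finite signed measure `s`:
the smallest measure `ν` such that `s(B) ≤ ν(B)` for all bounded Borel sets `B`. -/
def locPosPart {X : Type*} [PseudoMetricSpace X] [MeasurableSpace X]
    (s : Set X → ℝ) : Measure X :=
  sInf {ν : Measure X |
    ∀ B : Set X, Bornology.IsBounded B → MeasurableSet B → ENNReal.ofReal (s B) ≤ ν B}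

/-- The integral `∫ f dμ` of a function `f` (integrable with respect to `|μ|`) with respect to a
locally finite complex measure `μ`, by the Jordan decompositions of its real and imaginary
parts. -/
def locIntegral {X : Type*} [PseudoMetricSpace X] [MeasurableSpace X]
    (μ : Set X → ℂ) (f : X → ℂ) : ℂ :=
  (∫ x, f x ∂(locPosPart fun B => (μ B).re)) - (∫ x, f x ∂(locPosPart fun B => -(μ B).re)) +
    Complex.I * ((∫ x, f x ∂(locPosPart fun B => (μ B).im)) -
      (∫ x, f x ∂(locPosPart fun B => -(μ B).im)))

/-! ### Random complex measures -/

/-- `Φ` is a random locally finite complex measure: a measurable map into the space of locally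
finite complex measures, whose sigma-field is generated by the evaluations at bounded Borel
sets. -/
def IsRandomComplexMeasure {Ω X : Type*} [MeasurableSpace Ω] [PseudoMetricSpace X]
    [MeasurableSpace X] (Φ : Ω → Set X → ℂ) : Prop :=
  (∀ ω, IsLocComplexMeasure (Φ ω)) ∧
    ∀ B : Set X, Bornology.IsBounded B → MeasurableSet B → Measurable fun ω => Φ ω B

/-- Invariance under translations: `Φ(gω, gB) = Φ(ω, B)`, for a given action of the translation
group `ℝ^d` on `Ω`. -/
def IsInvariantMeasure {Ω : Type*} {d : ℕ} [AddAction (E d) Ω] (Φ : Ω → Set (E d) → ℂ) : Prop :=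
  ∀ (v : E d) (ω : Ω) (B : Set (E d)), Bornology.IsBounded B → MeasurableSet B →
    Φ (v +ᵥ ω) (v +ᵥ B) = Φ ω B

/-- A (nonnegative) random measure `Ψ` is locally square-integrable: `𝔼[Ψ(B)²] < ∞` for all
bounded Borel sets `B`. -/
def LocSquareIntegrable {Ω X : Type*} [MeasurableSpace Ω] [PseudoMetricSpace X]
    [MeasurableSpace X] (P : Measure Ω) (Ψ : Ω → Measure X) : Prop :=
  ∀ B : Set X, Bornology.IsBounded B → MeasurableSet B → ∫⁻ ω, (Ψ ω B) ^ 2 ∂P < ∞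

/-- A random complex measure `Φ` is locally absolutely square-integrable: `𝔼[|Φ|(B)²] < ∞` for
all bounded Borel sets `B`. -/
def LocAbsSquareIntegrable {Ω X : Type*} [MeasurableSpace Ω] [PseudoMetricSpace X]
    [MeasurableSpace X] (P : Measure Ω) (Φ : Ω → Set X → ℂ) : Prop :=
  LocSquareIntegrable P fun ω => locVariation (Φ ω)

/-- The sigma-field on `Ω` generated by a random complex measure. -/
@[reducible] def sigmaField {Ω X : Type*} [PseudoMetricSpace X] [MeasurableSpace X]
    (Φ : Ω → Set X → ℂ) : MeasurableSpace Ω :=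
  ⨆ (B : Set X) (_ : Bornology.IsBounded B) (_ : MeasurableSet B),
    MeasurableSpace.comap (fun ω => Φ ω B) inferInstance

/-! ### Transport kernels -/

/-- `K` is a random transport kernel: a kernel from `Ω × X` to `X` whose values are complex measures
(a `ComplexMeasure` automatically has finite total variation). -/
def IsTransportKernel {Ω X : Type*} [MeasurableSpace Ω] [MeasurableSpace X]
    (K : Ω → X → ComplexMeasure X) : Prop :=
  ∀ B : Set X, MeasurableSet B → Measurable fun p : Ω × X => K p.1 p.2 B

/-- Invariance of a random transport kernel under translations:
`K(gω, gx, gB) = K(ω, x, B)`. -/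
def IsInvariantKernel {Ω : Type*} {d : ℕ} [AddAction (E d) Ω]
    (K : Ω → E d → ComplexMeasure (E d)) : Prop :=
  ∀ (v : E d) (ω : Ω) (x : E d) (B : Set (E d)), MeasurableSet B →
    K (v +ᵥ ω) (v +ᵥ x) (v +ᵥ B) = K ω x B

/-- The kernel `K^*(ω, x, B) = K(ω, x, B + x)`, which describes the transport relative to the
position `x`. -/
def relKernel {Ω : Type*} {d : ℕ} (K : Ω → E d → ComplexMeasure (E d)) :
    Ω → E d → ComplexMeasure (E d) :=
  fun ω x => (K ω x).map fun z => z - x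

/-- The measure `|K||Φ|(ω, ·) = ∫ |K|(ω, x, ·) |Φ|(ω, dx)`. -/
def absDestination {Ω X : Type*} [PseudoMetricSpace X] [MeasurableSpace X]
    (K : Ω → X → ComplexMeasure X) (Φ : Ω → Set X → ℂ) (ω : Ω) : Measure X :=
  (locVariation (Φ ω)).bind fun x => (K ω x).variation

open Classical in
/-- The destination `KΦ(ω, B) = ∫ K(ω, x, B) Φ(ω, dx)`. It is well defined if
`|K||Φ|(ω, ·)` is locally finite; for the other `ω` it is set to `0`. -/
def destination {Ω X : Type*} [PseudoMetricSpace X] [MeasurableSpace X]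
    (K : Ω → X → ComplexMeasure X) (Φ : Ω → Set X → ℂ) : Ω → Set X → ℂ :=
  fun ω B =>
    if IsLocallyFiniteMeasure (absDestination K Φ ω) then
      locIntegral (Φ ω) fun x => K ω x B
    else 0

/-- `K` has uniformly bounded total variation. -/
def UniformlyBoundedVariation {Ω X : Type*} [MeasurableSpace X]
    (K : Ω → X → ComplexMeasure X) : Prop :=
  ∃ b : ℝ≥0, ∀ ω x, (K ω x).variation univ ≤ b

/-- `K`, as a random function of the position, is independent of `Φ`: there is a sigma-field
`𝒢` on `Ω` which carries all of the randomness of `K`, i.e., `(ω, x) ↦ K(ω, x, B)` is measurable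
with respect to the product of `𝒢` and the Borel sigma-field, and which is independent of the
sigma-field generated by `Φ`. -/
def IndepKernel {Ω X : Type*} [mΩ : MeasurableSpace Ω] [PseudoMetricSpace X]
    [mX : MeasurableSpace X] (P : Measure Ω) (K : Ω → X → ComplexMeasure X)
    (Φ : Ω → Set X → ℂ) : Prop :=
  ∃ 𝒢 : MeasurableSpace Ω, 𝒢 ≤ mΩ ∧
    (∀ B : Set X, MeasurableSet B →
      Measurable[MeasurableSpace.prod 𝒢 mX] fun p : Ω × X => K p.1 p.2 B) ∧
    Indep 𝒢 (sigmaField Φ) P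

/-! ### The two integrability conditions -/

/-- A strongly log-dominating function: a nondecreasing `ρ : [0, ∞) → [0, ∞)` with
`∫_0^∞ 1 / (r ρ(r) + 1) dr < ∞`. (Only the values of `ρ` on `[0, ∞)` matter.) -/
structure StronglyLogDominating (ρ : ℝ → ℝ) : Prop where
  nonneg : ∀ r, 0 ≤ r → 0 ≤ ρ r
  mono : MonotoneOn ρ (Ici 0)
  integrable : IntegrableOn (fun r => 1 / (r * ρ r + 1)) (Ioi 0)

/-- The random measure
`Ψ_{d,ρ}(dy) = (∫ √(‖x‖^d ρ(‖x‖) + 1) |K^*|(y, dx)) |Φ|(dy)`. -/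
def weightedSource {Ω : Type*} {d : ℕ} (K : Ω → E d → ComplexMeasure (E d))
    (Φ : Ω → Set (E d) → ℂ) (ρ : ℝ → ℝ) (ω : Ω) : Measure (E d) :=
  (locVariation (Φ ω)).withDensity fun y =>
    ∫⁻ x, ENNReal.ofReal (Real.sqrt (‖x‖ ^ d * ρ ‖x‖ + 1)) ∂(relKernel K ω y).variation

/-- For some strongly log-dominating `ρ`, the random measure `Ψ_{d,ρ}` is locally
square-integrable. -/
def GeneralCondition {Ω : Type*} [MeasurableSpace Ω] {d : ℕ} (P : Measure Ω)
    (K : Ω → E d → ComplexMeasure (E d)) (Φ : Ω → Set (E d) → ℂ) : Prop :=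
  ∃ ρ : ℝ → ℝ, StronglyLogDominating ρ ∧ LocSquareIntegrable P (weightedSource K Φ ρ)

/-- `K` has uniformly bounded total variation, `K` and `Φ` are independent, and
`𝔼[∫ ‖x‖^d |K_0|(dx)] < ∞`. -/
def IndependentCondition {Ω : Type*} [MeasurableSpace Ω] {d : ℕ} (P : Measure Ω)
    (K : Ω → E d → ComplexMeasure (E d)) (Φ : Ω → Set (E d) → ℂ) : Prop :=
  UniformlyBoundedVariation K ∧ IndepKernel P K Φ ∧
    ∫⁻ ω, ∫⁻ x, ‖x‖ₑ ^ d ∂(K ω 0).variation ∂P < ∞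

end Transport

end

/-! Everything reduces to a second moment bound for |K||Φ|. It gives almost sure local finiteness,
and the total variation of KΦ is at most 4|K||Φ|, because Φ has four Jordan components.

Cut ℝ^d into half-open unit cubes indexed by ℤ^d and let `flow n m` be the |K||Φ|-mass sent from
cube n into cube m. A bounded set meets finitely many cubes, and by invariance under lattice shifts
all cubes receive masses with the same second moment. So it suffices that the total inflow ∑_n `flow
n 0` into cube 0 is square-integrable (`locSquareIntegrable_of_tsum_flow`).

Under (a), apply Cauchy-Schwarz with weights u_n² = w(‖n‖ - √d), where w(r) = r^d ρ(r) + 1 and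
negative arguments are replaced by 0. The sum of the u_n⁻² is finite by comparison with ∫
r^(d-1)/w(r) dr. Invariance turns the flow from n into 0 into the flow from 0 into -n, and the
weighted sum of these outflows is at most Ψ_{d,ρ} of cube 0 (`tsum_flow_sq_lt_top_of_weights`).

Under (b), expand the square and charge each pair (n, m) to the index with the larger maximum norm.
The flow from the other cube is at most b|Φ|(cube m). Independence replaces the remaining kernel by
its mean, so each pair costs at most a constant times the expected mass sent from the origin to near
-n. There are (2|n|+1)^d partners m, which is why the moment of order d suffices
(`tsum_flow_sq_lt_top_of_decoupled`).

The preliminaries make |Φ|, |K| and the Jordan parts measurable in ω. The variation of a complex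
measure can be computed along a countable generating algebra (`variation_eq_variationAlong`), and
locally finite objects are sums over cubes (`locVariation_eq_sum`). -/

noncomputable section

namespace Transport

/-! ### Measurable dependence of the total variation on the measure -/

section Variation

variable {X : Type*} [mX : MeasurableSpace X]

lemma isFiniteMeasure_variation (c : ComplexMeasure X) : IsFiniteMeasure c.variation := by
  have h : c.variation ≤ (ComplexMeasure.re c).variation + (ComplexMeasure.im c).variation := by
    refine VectorMeasure.variation_le_of_forall_enorm_le fun B _ => ?_
    have h1 := (ComplexMeasure.re c).enorm_measure_le_variation B
    have h2 := (ComplexMeasure.im c).enorm_measure_le_variation B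
    refine le_trans ?_ (add_le_add h1 h2)
    have : c B = ((ComplexMeasure.re c B : ℝ) : ℂ) + ((ComplexMeasure.im c B : ℝ) : ℂ) * Complex.I :=
      (Complex.re_add_im (c B)).symm
    rw [this]
    refine (enorm_add_le _ _).trans ?_
    simp [← ofReal_norm]
  have h1 : IsFiniteMeasure (ComplexMeasure.re c).variation := by
    rw [← SignedMeasure.totalVariation_eq_variation]; infer_instance
  have h2 : IsFiniteMeasure (ComplexMeasure.im c).variation := by
    rw [← SignedMeasure.totalVariation_eq_variation]; infer_instance
  exact isFiniteMeasure_of_le _ h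

instance (c : ComplexMeasure X) : IsFiniteMeasure c.variation := isFiniteMeasure_variation c

/-- The finite disjoint families of sets from `𝒜`. -/
def disjointFamilies (𝒜 : Set (Set X)) : Set (Finset (Set X)) :=
  {π | (π : Set (Set X)) ⊆ 𝒜 ∧ (π : Set (Set X)).PairwiseDisjoint id}

/-- The variation on `B`, computed along partitions by sets from `𝒜`. -/
def variationAlong (𝒜 : Set (Set X)) (c : ComplexMeasure X) (B : Set X) : ℝ≥0∞ :=
  ⨆ π ∈ disjointFamilies 𝒜, ∑ C ∈ π, ‖c (B ∩ C)‖ₑ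

omit mX in
lemma countable_disjointFamilies {𝒜 : Set (Set X)} (h : 𝒜.Countable) :
    (disjointFamilies 𝒜).Countable :=
  Countable.mono (fun π (hπ : π ∈ disjointFamilies 𝒜) =>
      (⟨π.finite_toSet, hπ.1⟩ : (π : Set (Set X)) ∈ {t : Set (Set X) | t.Finite ∧ t ⊆ 𝒜}))
    ((countable_ofPred_finite_subset h).preimage Finset.coe_injective)

lemma enorm_le_variationAlong {𝒜 : Set (Set X)} (h : univ ∈ 𝒜) (c : ComplexMeasure X)
    (B : Set X) : ‖c B‖ₑ ≤ variationAlong 𝒜 c B := by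
  refine le_trans ?_ (le_iSup₂ (f := fun π (_ : π ∈ disjointFamilies 𝒜) =>
    ∑ C ∈ π, ‖c (B ∩ C)‖ₑ) {univ} ⟨by simpa using h, by simp⟩)
  simp

lemma sum_enorm_inter_le_variation (c : ComplexMeasure X) {A : Set X} (hA : MeasurableSet A)
    {π : Finset (Set X)} (hπ : (π : Set (Set X)).PairwiseDisjoint id) :
    ∑ C ∈ π, ‖c (A ∩ C)‖ₑ ≤ c.variation A := by
  classical
  have hd : (π : Set (Set X)).PairwiseDisjoint (fun C => A ∩ C) :=
    fun C hC C' hC' hne => (hπ hC hC' hne).mono inter_subset_right inter_subset_right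
  have := Finset.sum_image_of_disjoint (f := fun C => A ∩ C) (g := fun C => ‖c C‖ₑ) (by simp) hd
  rw [← this]
  refine c.le_variation hA ?_ ?_
  · intro t ht
    obtain ⟨C, -, rfl⟩ := Finset.mem_image.1 ht
    exact inter_subset_left
  · intro s hs t ht hne
    simp only [Finset.coe_image, mem_image] at hs ht
    obtain ⟨C, hC, rfl⟩ := hs
    obtain ⟨C', hC', rfl⟩ := ht
    exact hd hC hC' fun h => hne (by rw [h])

lemma sum_enorm_le_variation_of_inter (c : ComplexMeasure X) {A D : Set X}
    (hA : MeasurableSet A) (hD : MeasurableSet D)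
    {π : Finset (Set X)} (hπ : (π : Set (Set X)).PairwiseDisjoint id) :
    ∑ C ∈ π, ‖c (A ∩ (C ∩ D))‖ₑ ≤ c.variation (A ∩ D) := by
  refine le_trans (le_of_eq ?_) (sum_enorm_inter_le_variation c (hA.inter hD) hπ)
  refine Finset.sum_congr rfl fun C _ => ?_
  congr 2; ext; simp; tauto

lemma sum_enorm_split (c : ComplexMeasure X) {A A' D : Set X} (hA : MeasurableSet A)
    (hA' : MeasurableSet A') (hAA' : Disjoint A A') (hD : MeasurableSet D)
    {π : Finset (Set X)} (hm : ∀ C ∈ π, MeasurableSet C)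
    (hπ : (π : Set (Set X)).PairwiseDisjoint id) :
    ∑ C ∈ π, ‖c (A ∩ C)‖ₑ ≤
      ∑ C ∈ π, ‖c ((A ∪ A') ∩ (C ∩ D))‖ₑ + c.variation (A' ∩ D) + c.variation (A ∩ Dᶜ) := by
  have h1 : ∀ C ∈ π, ‖c (A ∩ C)‖ₑ ≤ ‖c ((A ∪ A') ∩ (C ∩ D))‖ₑ + ‖c (A' ∩ (C ∩ D))‖ₑ
      + ‖c (A ∩ (C ∩ Dᶜ))‖ₑ := by
    intro C hC
    have hC := hm C hC
    have e1 : c (A ∩ C) = c (A ∩ (C ∩ D)) + c (A ∩ (C ∩ Dᶜ)) := by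
      rw [← VectorMeasure.of_union]
      · congr 1; ext; simp; tauto
      · rw [disjoint_left]; simp; tauto
      · measurability
      · measurability
    have e2 : c ((A ∪ A') ∩ (C ∩ D)) = c (A ∩ (C ∩ D)) + c (A' ∩ (C ∩ D)) := by
      rw [← VectorMeasure.of_union]
      · congr 1; ext; simp; tauto
      · exact hAA'.mono inter_subset_left inter_subset_left
      · measurability
      · measurability
    have e3 : c (A ∩ C) = c ((A ∪ A') ∩ (C ∩ D)) - c (A' ∩ (C ∩ D)) + c (A ∩ (C ∩ Dᶜ)) := by
      rw [e1, e2]; ring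
    rw [e3]
    exact (enorm_add_le _ _).trans (add_le_add enorm_sub_le le_rfl)
  refine (Finset.sum_le_sum h1).trans ?_
  rw [Finset.sum_add_distrib, Finset.sum_add_distrib]
  gcongr
  · exact sum_enorm_le_variation_of_inter c hA' hD hπ
  · exact sum_enorm_le_variation_of_inter c hA hD.compl hπ

/-- Two families from 𝒜, one tested on A and one on A', must be merged into a single disjoint
family. Approximate A by some D in 𝒜 and cut the first family by D, the second by Dᶜ. The error
consists of four variations over parts of the symmetric difference of A and D, hence the ε/4. -/
lemma variationAlong_superadditive {𝒜 : Set (Set X)} (h𝒜 : IsSetAlgebra 𝒜)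
    (hgen : mX = MeasurableSpace.generateFrom 𝒜) (c : ComplexMeasure X) {A A' : Set X}
    (hA : MeasurableSet A) (hA' : MeasurableSet A') (hAA' : Disjoint A A') :
    variationAlong 𝒜 c A + variationAlong 𝒜 c A' ≤ variationAlong 𝒜 c (A ∪ A') := by
  classical
  have hmeas : ∀ C ∈ 𝒜, MeasurableSet C := fun C hC => by
    rw [hgen]; exact MeasurableSpace.measurableSet_generateFrom hC
  unfold variationAlong
  have hne : (disjointFamilies 𝒜).Nonempty := ⟨∅, by simp, by simp⟩
  refine ENNReal.biSup_add_biSup_le hne hne fun π hπ π' hπ' => ?_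
  refine ENNReal.le_of_forall_pos_le_add fun ε hε _ => ?_
  have hε4 : (0 : ℝ≥0∞) < (ε : ℝ≥0∞) / 4 := by simp [ENNReal.div_pos_iff, hε.ne']
  obtain ⟨D, hD𝒜, hD⟩ := exists_measure_symmDiff_lt_of_generateFrom_isSetRing
    (μ := c.variation) h𝒜.isSetRing
    ⟨{univ}, by simp, by simpa using h𝒜.univ_mem, by simp⟩ hgen hA hε4
  have hDm := hmeas D hD𝒜
  have b1 : c.variation (A' ∩ D) ≤ ε / 4 := by
    refine (measure_mono ?_).trans hD.le
    intro x hx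
    exact Or.inl ⟨hx.2, fun hxA => disjoint_left.1 hAA' hxA hx.1⟩
  have b2 : c.variation (A ∩ Dᶜ) ≤ ε / 4 := by
    refine (measure_mono ?_).trans hD.le
    intro x hx
    exact Or.inr ⟨hx.1, hx.2⟩
  have s1 := sum_enorm_split c hA hA' hAA' hDm (fun C hC => hmeas C (hπ.1 hC)) hπ.2
  have s2 := sum_enorm_split c hA' hA hAA'.symm hDm.compl (fun C hC => hmeas C (hπ'.1 hC)) hπ'.2
  rw [compl_compl, union_comm] at s2
  set τ := π.image (fun C => C ∩ D) ∪ π'.image (fun C => C ∩ Dᶜ)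
  have hd1 : (π : Set (Set X)).PairwiseDisjoint (fun C => C ∩ D) :=
    fun C hC C' hC' hne => (hπ.2 hC hC' hne).mono inter_subset_left inter_subset_left
  have hd2 : (π' : Set (Set X)).PairwiseDisjoint (fun C => C ∩ Dᶜ) :=
    fun C hC C' hC' hne => (hπ'.2 hC hC' hne).mono inter_subset_left inter_subset_left
  have hτ : τ ∈ disjointFamilies 𝒜 := by
    constructor
    · intro s hs
      simp only [τ, Finset.coe_union, Finset.coe_image, mem_union, mem_image] at hs
      rcases hs with ⟨C, hC, rfl⟩ | ⟨C, hC, rfl⟩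
      · exact h𝒜.inter_mem (hπ.1 hC) hD𝒜
      · exact h𝒜.inter_mem (hπ'.1 hC) (h𝒜.compl_mem hD𝒜)
    · intro s hs t ht hne
      simp only [τ, Finset.coe_union, Finset.coe_image, mem_union, mem_image] at hs ht
      rcases hs with ⟨C, hC, rfl⟩ | ⟨C, hC, rfl⟩ <;> rcases ht with ⟨C', hC', rfl⟩ | ⟨C', hC', rfl⟩
      · exact hd1 hC hC' fun h => hne (by rw [h])
      · exact disjoint_compl_right.mono inter_subset_right inter_subset_right
      · exact disjoint_compl_left.mono inter_subset_right inter_subset_right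
      · exact hd2 hC hC' fun h => hne (by rw [h])
  have hsum : ∑ C ∈ τ, ‖c ((A ∪ A') ∩ C)‖ₑ = ∑ C ∈ π, ‖c ((A ∪ A') ∩ (C ∩ D))‖ₑ
      + ∑ C ∈ π', ‖c ((A ∪ A') ∩ (C ∩ Dᶜ))‖ₑ := by
    rw [← Finset.sum_image_of_disjoint (f := fun C => C ∩ D)
        (g := fun C => ‖c ((A ∪ A') ∩ C)‖ₑ) (by simp) hd1,
      ← Finset.sum_image_of_disjoint (f := fun C => C ∩ Dᶜ)
        (g := fun C => ‖c ((A ∪ A') ∩ C)‖ₑ) (by simp) hd2, ← Finset.sum_union_inter]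
    -- The two cut families can share only the empty set, which contributes 0.
    rw [Finset.sum_eq_zero (s := _ ∩ _), add_zero]
    intro s hs
    simp only [Finset.mem_inter, Finset.mem_image] at hs
    obtain ⟨⟨C, _, rfl⟩, ⟨C', _, h⟩⟩ := hs
    have : C ∩ D = ∅ := by
      ext x
      simp only [mem_inter_iff, mem_empty_iff_false, iff_false]
      intro hx
      have : x ∈ C' ∩ Dᶜ := by rw [h]; exact hx
      exact this.2 hx.2
    simp [this]
  have hle := le_iSup₂ (f := fun π (_ : π ∈ disjointFamilies 𝒜) =>
    ∑ C ∈ π, ‖c ((A ∪ A') ∩ C)‖ₑ) τ hτ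
  simp only [hsum] at hle
  calc _ ≤ _ := add_le_add s1 s2
    _ ≤ (∑ C ∈ π, ‖c ((A ∪ A') ∩ (C ∩ D))‖ₑ + ε / 4 + ε / 4)
        + (∑ C ∈ π', ‖c ((A ∪ A') ∩ (C ∩ Dᶜ))‖ₑ + ε / 4 + ε / 4) := by gcongr
    _ = (∑ C ∈ π, ‖c ((A ∪ A') ∩ (C ∩ D))‖ₑ + ∑ C ∈ π', ‖c ((A ∪ A') ∩ (C ∩ Dᶜ))‖ₑ)
        + 4 * (ε / 4) := by ring
    _ ≤ _ := by
        rw [ENNReal.mul_div_cancel (by simp) (by simp)]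
        gcongr

lemma sum_enorm_le_variationAlong {𝒜 : Set (Set X)} (h𝒜 : IsSetAlgebra 𝒜)
    (hgen : mX = MeasurableSpace.generateFrom 𝒜) (c : ComplexMeasure X) (P : Finset (Set X))
    (hm : ∀ t ∈ P, MeasurableSet t) (hd : (P : Set (Set X)).PairwiseDisjoint id) :
    ∑ p ∈ P, ‖c p‖ₑ ≤ variationAlong 𝒜 c (⋃ p ∈ P, p) := by
  classical
  induction P using Finset.induction_on with
  | empty => simp
  | insert s P hs ih =>
    rw [Finset.sum_insert hs, Finset.set_biUnion_insert]
    refine le_trans (add_le_add (enorm_le_variationAlong h𝒜.univ_mem c s)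
      (ih (fun t ht => hm t (Finset.mem_insert_of_mem ht))
        (hd.subset (by simp)))) ?_
    refine variationAlong_superadditive h𝒜 hgen c (hm s (by simp))
      (P.measurableSet_biUnion fun t ht => hm t (Finset.mem_insert_of_mem ht)) ?_
    simp only [disjoint_iUnion_right]
    intro t ht
    exact hd (by simp) (by simp [ht]) fun h => hs (h ▸ ht)

/-- Since 𝒜 contains the whole space, ‖c p‖ is at most the variation along 𝒜 on p; superadditivity
adds this up over any finite measurable partition, although its pieces need not lie in 𝒜. -/
lemma variation_eq_variationAlong {𝒜 : Set (Set X)} (h𝒜 : IsSetAlgebra 𝒜)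
    (hgen : mX = MeasurableSpace.generateFrom 𝒜) (c : ComplexMeasure X) {B : Set X}
    (hB : MeasurableSet B) : c.variation B = variationAlong 𝒜 c B := by
  refine le_antisymm ?_ (iSup₂_le fun π hπ => sum_enorm_inter_le_variation c hB hπ.2)
  refine le_of_forall_lt fun a ha => ?_
  obtain ⟨P, hP, hd, hm, hlt⟩ := c.exists_lt_sum_of_lt_variation hB ha
  refine hlt.trans_le ((sum_enorm_le_variationAlong h𝒜 hgen c P hm hd).trans ?_)
  have hU : MeasurableSet (⋃ p ∈ P, p) := P.measurableSet_biUnion hm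
  have hsub : (⋃ p ∈ P, p) ⊆ B := iUnion₂_subset hP
  have := variationAlong_superadditive h𝒜 hgen c hU (hB.diff hU) disjoint_sdiff_right
  rw [union_sdiff_cancel hsub] at this
  exact le_self_add.trans this

/-- A countable generating algebra has countably many finite disjoint families, so the variation is
a countable supremum of measurable functions. -/
theorem measurable_variation [MeasurableSpace.CountablyGenerated X] {T : Type*}
    [MeasurableSpace T] {c : T → ComplexMeasure X}
    (hc : ∀ B, MeasurableSet B → Measurable fun t => c t B) :
    Measurable fun t => (c t).variation := by
  obtain ⟨b, hb, hgen⟩ := MeasurableSpace.CountablyGenerated.isCountablyGenerated (α := X)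
  have h𝒜 := isSetAlgebra_generateSetAlgebra (𝒜 := b)
  have hgen' : mX = MeasurableSpace.generateFrom (generateSetAlgebra b) := by
    rw [generateFrom_generateSetAlgebra_eq, hgen]
  refine Measure.measurable_of_measurable_coe _ fun B hB => ?_
  simp_rw [variation_eq_variationAlong h𝒜 hgen' _ hB]
  refine Measurable.biSup _ (countable_disjointFamilies (countable_generateSetAlgebra hb)) fun π hπ => ?_
  refine Finset.measurable_fun_sum _ fun C hC => ?_
  refine (hc _ (hB.inter ?_)).enorm
  rw [hgen']; exact MeasurableSpace.measurableSet_generateFrom (hπ.1 hC)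

end Variation

/-! ### Jordan components of a complex measure -/

section PositivePart

variable {X : Type*} [mX : MeasurableSpace X]

/-- The positive part of the real part of a complex measure. -/
def posPartRe (c : ComplexMeasure X) : Measure X :=
  (ComplexMeasure.re c).toJordanDecomposition.posPart

instance (c : ComplexMeasure X) : IsFiniteMeasure (posPartRe c) := by
  unfold posPartRe; infer_instance

lemma posPartRe_le {c : ComplexMeasure X} {ν : Measure X}
    (h : ∀ B, MeasurableSet B → ENNReal.ofReal (c B).re ≤ ν B) : posPartRe c ≤ ν := by
  obtain ⟨i, hi, hpos, hneg, hp, -⟩ := (ComplexMeasure.re c).toJordanDecomposition_spec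
  refine Measure.le_intro fun B hB _ => ?_
  rw [posPartRe, hp, SignedMeasure.toMeasureOfZeroLE_apply _ hpos hi hB]
  refine le_trans (le_of_eq ?_) ((h _ (hi.inter hB)).trans (measure_mono inter_subset_right))
  rw [← ENNReal.ofReal_coe_nnreal]
  rfl

lemma re_eq_posPartRe_sub (c : ComplexMeasure X) {B : Set X} (hB : MeasurableSet B) :
    (c B).re = (posPartRe c).real B - (posPartRe (-c)).real B := by
  have h := (ComplexMeasure.re c).apply_eq_posPart_real_sub_negPart_real hB
  have h2 : posPartRe (-c) = (ComplexMeasure.re c).toJordanDecomposition.negPart := by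
    rw [posPartRe, map_neg, SignedMeasure.toJordanDecomposition_neg,
      JordanDecomposition.neg_posPart]
  rw [h2]
  exact h

lemma ofReal_re_le_posPartRe (c : ComplexMeasure X) {B : Set X} (hB : MeasurableSet B) :
    ENNReal.ofReal (c B).re ≤ posPartRe c B := by
  rw [re_eq_posPartRe_sub c hB, ← ofReal_measureReal]
  exact ENNReal.ofReal_le_ofReal (sub_le_self _ measureReal_nonneg)

lemma ofReal_re_le_enorm (z : ℂ) : ENNReal.ofReal z.re ≤ ‖z‖ₑ := by
  rw [← ofReal_norm]
  exact ENNReal.ofReal_le_ofReal (Complex.re_le_norm z)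

lemma posPartRe_smul_le_variation {a : ℂ} (ha : ‖a‖ = 1) (c : ComplexMeasure X) :
    posPartRe (a • c) ≤ c.variation :=
  posPartRe_le fun B _ => (ofReal_re_le_enorm _).trans <| by
    rw [smul_apply, enorm_smul, ← ofReal_norm a, ha]
    simpa using c.enorm_measure_le_variation B

/-- As Im z = Re(-iz), all four Jordan components are positive real parts of a • c with a = 1, -1,
-i, i. This lets one unit factor `a` index them throughout. -/
lemma apply_eq_posPartRe (c : ComplexMeasure X) {B : Set X} (hB : MeasurableSet B) :
    c B = (((posPartRe c).real B - (posPartRe (-c)).real B : ℝ) : ℂ) + Complex.I *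
      (((posPartRe (-Complex.I • c)).real B - (posPartRe (Complex.I • c)).real B : ℝ) : ℂ) := by
  have h1 := re_eq_posPartRe_sub c hB
  have h2 := re_eq_posPartRe_sub (-Complex.I • c) hB
  have h3 : -(-Complex.I • c) = Complex.I • c := by ext B hB; simp
  rw [h3] at h2
  rw [← h1, ← h2]
  apply Complex.ext <;> simp

lemma totalVariation_eq_posPartRe_add (c : ComplexMeasure X) :
    (ComplexMeasure.re c).variation = posPartRe c + posPartRe (-c) := by
  have h2 : posPartRe (-c) = (ComplexMeasure.re c).toJordanDecomposition.negPart := by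
    rw [posPartRe, map_neg, SignedMeasure.toJordanDecomposition_neg,
      JordanDecomposition.neg_posPart]
  rw [← SignedMeasure.totalVariation_eq_variation, h2]
  rfl

/-- The positive part of a signed measure s is (|s| + s)/2, and |s| is measurable once s is viewed
as a complex measure with zero imaginary part. -/
theorem measurable_posPartRe [MeasurableSpace.CountablyGenerated X] {T : Type*}
    [MeasurableSpace T] {c : T → ComplexMeasure X}
    (hc : ∀ B, MeasurableSet B → Measurable fun t => c t B) :
    Measurable fun t => posPartRe (c t) := by
  have hm : Measurable fun t =>
      (SignedMeasure.toComplexMeasure (ComplexMeasure.re (c t)) 0).variation := by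
    refine measurable_variation fun B hB => ?_
    have : ∀ t, SignedMeasure.toComplexMeasure (ComplexMeasure.re (c t)) 0 B
        = (((c t B).re : ℝ) : ℂ) := fun t => by
      rw [SignedMeasure.toComplexMeasure_apply]
      rfl
    simp_rw [this]
    exact Complex.measurable_ofReal.comp (Complex.measurable_re.comp (hc B hB))
  have hv : ∀ s : SignedMeasure X,
      (SignedMeasure.toComplexMeasure s 0).variation = s.variation := by
    intro s
    have he : ∀ B, ‖SignedMeasure.toComplexMeasure s 0 B‖ₑ = ‖s B‖ₑ := fun B => by
      have : SignedMeasure.toComplexMeasure s 0 B = ((s B : ℝ) : ℂ) := by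
        apply Complex.ext <;> simp [SignedMeasure.toComplexMeasure_apply]
      rw [this, ← ofReal_norm, ← ofReal_norm, Complex.norm_real]
    refine le_antisymm ?_ ?_ <;> refine VectorMeasure.variation_le_of_forall_enorm_le fun B _ => ?_
    · rw [he]; exact s.enorm_measure_le_variation B
    · rw [← he]; exact VectorMeasure.enorm_measure_le_variation _ B
  simp_rw [hv, totalVariation_eq_posPartRe_add] at hm
  refine Measure.measurable_of_measurable_coe _ fun B hB => ?_
  have h1 := (Measure.measurable_coe hB).comp hm
  have h2 : (fun t => posPartRe (c t) B) = fun t => ENNReal.ofReal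
      ((((posPartRe (c t) + posPartRe (-(c t))) B).toReal + (c t B).re) / 2) := by
    funext t
    rw [re_eq_posPartRe_sub _ hB, Measure.add_apply,
      ENNReal.toReal_add (measure_ne_top _ _) (measure_ne_top _ _)]
    conv_lhs => rw [← ofReal_measureReal]
    congr 1
    simp only [measureReal_def]
    ring
  rw [h2]
  exact ((h1.ennreal_toReal.add (Complex.measurable_re.comp (hc B hB))).div_const 2).ennreal_ofReal

end PositivePart

/-! ### S-finiteness of kernels without a uniform mass bound -/

section SFinite

variable {T X ι : Type*} [MeasurableSpace T] [MeasurableSpace X]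

/-- Sort the parameters by the integer part of the total mass: on each class the mass is uniformly
bounded. -/
lemma isSFiniteKernel_of_isFiniteMeasure (κ : Kernel T X) (h : ∀ t, IsFiniteMeasure (κ t)) :
    IsSFiniteKernel κ := by
  classical
  have hS : ∀ k : ℕ, MeasurableSet {t | ⌊(κ t univ).toReal⌋₊ = k} := fun k =>
    (Nat.measurable_floor.comp (κ.measurable_coe MeasurableSet.univ).ennreal_toReal)
      (measurableSet_singleton k)
  have hfin : ∀ k : ℕ, IsFiniteKernel (Kernel.piecewise (hS k) κ 0) := fun k => by
    refine ⟨⟨(k + 1 : ℕ), ENNReal.natCast_lt_top _, fun t => ?_⟩⟩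
    rw [Kernel.piecewise_apply]
    split_ifs with ht
    · rw [← ENNReal.ofReal_toReal (measure_ne_top (κ t) univ), ← ENNReal.ofReal_natCast]
      refine ENNReal.ofReal_le_ofReal ?_
      rw [← (show ⌊(κ t univ).toReal⌋₊ = k from ht)]
      push_cast
      exact (Nat.lt_floor_add_one _).le
    · simp
  have hsum : κ = Kernel.sum fun k : ℕ => Kernel.piecewise (hS k) κ 0 := by
    ext t B hB
    rw [Kernel.sum_apply' _ _ hB, tsum_eq_single ⌊(κ t univ).toReal⌋₊]
    · rw [Kernel.piecewise_apply, if_pos (by simp)]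
    · intro k hk
      rw [Kernel.piecewise_apply, if_neg (by simpa using hk.symm)]
      simp
  rw [hsum]
  infer_instance

lemma isSFiniteKernel_of_eq_sum [Countable ι] (κ : Kernel T X) {ν : ι → T → Measure X}
    (hν : ∀ i, Measurable (ν i)) (hfin : ∀ i t, IsFiniteMeasure (ν i t))
    (h : ∀ t, κ t = Measure.sum fun i => ν i t) : IsSFiniteKernel κ := by
  have : κ = Kernel.sum fun i => (⟨ν i, hν i⟩ : Kernel T X) := by
    ext t B hB
    rw [h, Kernel.sum_apply]
    rfl
  rw [this]
  have : ∀ i, IsSFiniteKernel (⟨ν i, hν i⟩ : Kernel T X) := fun i =>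
    isSFiniteKernel_of_isFiniteMeasure _ (hfin i)
  infer_instance

lemma measurable_sum_measure [Countable ι] {ν : ι → T → Measure X}
    (hν : ∀ i, Measurable (ν i)) : Measurable fun t => Measure.sum fun i => ν i t := by
  refine Measure.measurable_of_measurable_coe _ fun B hB => ?_
  simp_rw [Measure.sum_apply _ hB]
  exact Measurable.tsum fun i => (Measure.measurable_coe hB).comp (hν i)

end SFinite

/-! ### The partition of ℝ^d into half-open unit cubes -/

section Cells

variable {d : ℕ}

/-- The coordinatewise integer part. -/
def intPart (x : E d) : Fin d → ℤ := fun i => ⌊x i⌋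

/-- The half-open unit cube with lower corner `n`. -/
def cell (n : Fin d → ℤ) : Set (E d) := intPart ⁻¹' {n}

/-- The integer point `n` as an element of `ℝ^d`. -/
def latticePt (n : Fin d → ℤ) : E d := WithLp.toLp 2 fun i => (n i : ℝ)

lemma measurable_intPart : Measurable (intPart : E d → Fin d → ℤ) :=
  measurable_pi_lambda _ fun i => Int.measurable_floor.comp (by fun_prop)

lemma measurableSet_cell (n : Fin d → ℤ) : MeasurableSet (cell n) :=
  measurable_intPart (measurableSet_singleton n)

lemma mem_cell {n : Fin d → ℤ} {x : E d} : x ∈ cell n ↔ intPart x = n := Iff.rfl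

lemma pairwise_disjoint_cell : Pairwise (Function.onFun Disjoint (cell : (Fin d → ℤ) → Set (E d))) :=
  fun _ _ h => disjoint_left.2 fun _ hx hy => h (hx.symm.trans hy)

lemma iUnion_cell : ⋃ n, (cell n : Set (E d)) = univ :=
  eq_univ_of_forall fun x => mem_iUnion.2 ⟨intPart x, rfl⟩

lemma intPart_latticePt_add (n : Fin d → ℤ) (x : E d) :
    intPart (latticePt n + x) = n + intPart x := by
  funext i
  simp [intPart, latticePt]

lemma norm_le_of_forall_abs_le {x : E d} {r : ℝ} (hr : 0 ≤ r) (h : ∀ i, |x i| ≤ r) :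
    ‖x‖ ≤ √d * r := by
  rw [EuclideanSpace.norm_eq]
  calc √(∑ i, ‖x i‖ ^ 2) ≤ √(∑ _i : Fin d, r ^ 2) := by
        refine Real.sqrt_le_sqrt (Finset.sum_le_sum fun i _ => ?_)
        rw [Real.norm_eq_abs]
        exact pow_le_pow_left₀ (abs_nonneg _) (h i) 2
    _ = √d * r := by
        rw [Finset.sum_const, Finset.card_univ, Fintype.card_fin, nsmul_eq_mul,
          Real.sqrt_mul (by positivity), Real.sqrt_sq hr]

lemma norm_sub_latticePt_le {n : Fin d → ℤ} {x : E d} (hx : x ∈ cell n) :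
    ‖x - latticePt n‖ ≤ √d := by
  have := norm_le_of_forall_abs_le (x := x - latticePt n) (r := 1) zero_le_one fun i => by
    have h : ⌊x i⌋ = n i := congrFun hx i
    simp only [PiLp.sub_apply, latticePt]
    rw [← h, abs_le]
    constructor
    · linarith [Int.floor_le (x i)]
    · linarith [Int.lt_floor_add_one (x i)]
  simpa using this

lemma isBounded_cell (n : Fin d → ℤ) : Bornology.IsBounded (cell n : Set (E d)) := by
  refine (Metric.isBounded_closedBall (x := latticePt n) (r := √d)).subset fun x hx => ?_
  rw [Metric.mem_closedBall, dist_eq_norm]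
  exact norm_sub_latticePt_le hx

end Cells

/-! ### Locally finite complex measures as sums over cells -/

section Local

variable {X : Type*} [PseudoMetricSpace X] [MeasurableSpace X] {μ : Set X → ℂ}

lemma IsLocComplexMeasure.exists_eq_inter [ProperSpace X] (h : IsLocComplexMeasure μ) {Q : Set X}
    (hQ : Bornology.IsBounded Q) (hQm : MeasurableSet Q) :
    ∃ c : ComplexMeasure X, ∀ A, MeasurableSet A → c A = μ (A ∩ Q) := by
  obtain ⟨μ₁, μ₂, μ₃, μ₄, h₁, h₂, h₃, h₄, h⟩ := h
  have hf : ∀ ν : Measure X, IsLocallyFiniteMeasure ν → IsFiniteMeasure (ν.restrict Q) :=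
    fun ν hν => ⟨by
      rw [Measure.restrict_apply_univ]
      exact hQ.measure_lt_top⟩
  have f₁ := hf μ₁ h₁
  have f₂ := hf μ₂ h₂
  have f₃ := hf μ₃ h₃
  have f₄ := hf μ₄ h₄
  refine ⟨SignedMeasure.toComplexMeasure
    ((μ₁.restrict Q).toSignedMeasure - (μ₂.restrict Q).toSignedMeasure)
    ((μ₃.restrict Q).toSignedMeasure - (μ₄.restrict Q).toSignedMeasure), fun A hA => ?_⟩
  rw [h _ (hQ.subset inter_subset_right) (hA.inter hQm)]
  simp only [SignedMeasure.toComplexMeasure_apply, sub_apply,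
    Measure.toSignedMeasure_apply_measurable hA, measureReal_restrict_apply hA]
  apply Complex.ext <;> simp

end Local

section LocalCells

variable {d : ℕ} {μ : Set (E d) → ℂ}

/-- The restriction of a locally finite complex measure to a cell. -/
def cellMeasure (h : IsLocComplexMeasure μ) (n : Fin d → ℤ) : ComplexMeasure (E d) :=
  (h.exists_eq_inter (isBounded_cell n) (measurableSet_cell n)).choose

lemma cellMeasure_apply (h : IsLocComplexMeasure μ) (n : Fin d → ℤ) {A : Set (E d)}
    (hA : MeasurableSet A) : cellMeasure h n A = μ (A ∩ cell n) :=
  (h.exists_eq_inter (isBounded_cell n) (measurableSet_cell n)).choose_spec A hA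

lemma IsLocComplexMeasure.hasSum_cell (h : IsLocComplexMeasure μ) {B : Set (E d)}
    (hB : Bornology.IsBounded B) (hBm : MeasurableSet B) :
    HasSum (fun n => μ (B ∩ cell n)) (μ B) := by
  obtain ⟨c, hc⟩ := h.exists_eq_inter hB hBm
  have := c.hasSum_of_disjoint_iUnion measurableSet_cell pairwise_disjoint_cell
  rw [iUnion_cell, hc _ MeasurableSet.univ, univ_inter] at this
  simpa only [hc _ (measurableSet_cell _), inter_comm] using this

lemma measure_eq_tsum_cell (ν : Measure (E d)) {B : Set (E d)} (hB : MeasurableSet B) :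
    ν B = ∑' n, ν (B ∩ cell n) := by
  rw [← measure_iUnion, ← inter_iUnion, iUnion_cell, inter_univ]
  · exact fun n m hnm => (pairwise_disjoint_cell hnm).mono inter_subset_right inter_subset_right
  · exact fun n => hB.inter (measurableSet_cell n)

lemma sum_restrict_cell (ν : Measure (E d)) : Measure.sum (fun n => ν.restrict (cell n)) = ν := by
  rw [← Measure.restrict_iUnion pairwise_disjoint_cell measurableSet_cell, iUnion_cell,
    Measure.restrict_univ]

/-- The sum over cells dominates μ by σ-additivity, so it competes in the infimum; conversely each
competitor, restricted to a cell, dominates the variation there. Questions on |μ| thus reduce to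
finite complex measures. -/
theorem locVariation_eq_sum (h : IsLocComplexMeasure μ) :
    locVariation μ = Measure.sum fun n => (cellMeasure h n).variation := by
  refine le_antisymm (sInf_le fun B hB hBm => ?_) (le_sInf fun ν hν => ?_)
  · rw [Measure.sum_apply _ hBm, ← (h.hasSum_cell hB hBm).tsum_eq]
    refine enorm_tsum_le_tsum_enorm.trans (ENNReal.tsum_le_tsum fun n => ?_)
    rw [← cellMeasure_apply h n hBm]
    exact (cellMeasure h n).enorm_measure_le_variation B
  · refine Measure.le_intro fun B hBm _ => ?_
    rw [Measure.sum_apply _ hBm, measure_eq_tsum_cell ν hBm]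
    refine ENNReal.tsum_le_tsum fun n => ?_
    rw [← Measure.restrict_apply hBm]
    refine VectorMeasure.variation_le_of_forall_enorm_le (m := ν.restrict (cell n)) (fun A hA => ?_) B
    rw [cellMeasure_apply h n hA, Measure.restrict_apply hA]
    exact hν _ ((isBounded_cell n).subset inter_subset_right) (hA.inter (measurableSet_cell n))

lemma enorm_le_locVariation (h : IsLocComplexMeasure μ) {B : Set (E d)}
    (hB : Bornology.IsBounded B) (hBm : MeasurableSet B) : ‖μ B‖ₑ ≤ locVariation μ B := by
  rw [locVariation_eq_sum h, Measure.sum_apply _ hBm, ← (h.hasSum_cell hB hBm).tsum_eq]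
  refine enorm_tsum_le_tsum_enorm.trans (ENNReal.tsum_le_tsum fun n => ?_)
  rw [← cellMeasure_apply h n hBm]
  exact (cellMeasure h n).enorm_measure_le_variation B

lemma ofReal_le_tsum_ofReal {ι : Type*} {f : ι → ℝ} {a : ℝ} (h : HasSum f a) :
    ENNReal.ofReal a ≤ ∑' i, ENNReal.ofReal (f i) := by
  have h2 : Summable fun i => max (f i) 0 :=
    h.summable.abs.of_nonneg_of_le (fun _ => le_max_right _ _)
      fun i => max_le (le_abs_self _) (abs_nonneg _)
  calc ENNReal.ofReal a ≤ ENNReal.ofReal (∑' i, max (f i) 0) :=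
        ENNReal.ofReal_le_ofReal (hasSum_le (fun i => le_max_left _ _) h h2.hasSum)
    _ = ∑' i, ENNReal.ofReal (max (f i) 0) :=
        ENNReal.ofReal_tsum_of_nonneg (fun _ => le_max_right _ _) h2
    _ = _ := by
        congr with i
        rcases le_total (f i) 0 with h | h
        · simp [h]
        · simp [h]

theorem locPosPart_eq_sum (h : IsLocComplexMeasure μ) (a : ℂ) :
    locPosPart (fun B => (a * μ B).re) = Measure.sum fun n => posPartRe (a • cellMeasure h n) := by
  refine le_antisymm (sInf_le fun B hB hBm => ?_) (le_sInf fun ν hν => ?_)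
  · rw [Measure.sum_apply _ hBm]
    have hs : HasSum (fun n => (a * μ (B ∩ cell n)).re) (a * μ B).re :=
      Complex.hasSum_re ((h.hasSum_cell hB hBm).mul_left a)
    refine (ofReal_le_tsum_ofReal hs).trans (ENNReal.tsum_le_tsum fun n => ?_)
    rw [← cellMeasure_apply h n hBm]
    exact ofReal_re_le_posPartRe (a • cellMeasure h n) hBm
  · refine Measure.le_intro fun B hBm _ => ?_
    rw [Measure.sum_apply _ hBm, measure_eq_tsum_cell ν hBm]
    refine ENNReal.tsum_le_tsum fun n => ?_
    rw [← Measure.restrict_apply hBm]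
    refine posPartRe_le (ν := ν.restrict (cell n)) (fun A hA => ?_) B
    rw [smul_apply, cellMeasure_apply h n hA, Measure.restrict_apply hA]
    exact hν _ ((isBounded_cell n).subset inter_subset_right) (hA.inter (measurableSet_cell n))

lemma locPosPart_le_locVariation (h : IsLocComplexMeasure μ) {a : ℂ} (ha : ‖a‖ = 1) :
    locPosPart (fun B => (a * μ B).re) ≤ locVariation μ := by
  refine sInf_le fun B hB hBm => (ofReal_re_le_enorm _).trans ?_
  rw [enorm_mul, ← ofReal_norm a, ha]
  simpa using enorm_le_locVariation h hB hBm

lemma locVariation_le_map_add {μ μ' : Set (E d) → ℂ} (h : IsLocComplexMeasure μ) {v : E d}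
    (hv : ∀ B, Bornology.IsBounded B → MeasurableSet B → μ' (v +ᵥ B) = μ B) :
    locVariation μ' ≤ (locVariation μ).map fun x => v + x := by
  refine sInf_le fun B hB hBm => ?_
  rw [Measure.map_apply (by fun_prop) hBm]
  have hp : (fun x => v + x) ⁻¹' B = -v +ᵥ B := by
    ext x; simp [mem_vadd_set_iff_neg_vadd_mem]
  have hb : Bornology.IsBounded (-v +ᵥ B) := hB.vadd (-v)
  have hm : MeasurableSet (-v +ᵥ B) := hBm.const_vadd (-v)
  have := hv _ hb hm
  rw [vadd_vadd, add_neg_cancel, zero_vadd] at this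
  rw [this, hp]
  exact enorm_le_locVariation h hb hm

/-- The one-sided bound for v is combined with the one for -v. -/
theorem locVariation_eq_map_add {μ μ' : Set (E d) → ℂ} (h : IsLocComplexMeasure μ)
    (h' : IsLocComplexMeasure μ') {v : E d}
    (hv : ∀ B, Bornology.IsBounded B → MeasurableSet B → μ' (v +ᵥ B) = μ B) :
    locVariation μ' = (locVariation μ).map fun x => v + x := by
  refine le_antisymm (locVariation_le_map_add h hv) ?_
  have h2 := locVariation_le_map_add (μ := μ') (μ' := μ) (v := -v) h' fun B hB hBm => by
    rw [← hv _ (hB.vadd (-v)) (hBm.const_vadd (-v)), vadd_vadd, add_neg_cancel, zero_vadd]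
  refine (Measure.map_mono h2 (by fun_prop)).trans ?_
  rw [Measure.map_map (by fun_prop) (by fun_prop)]
  have : ((fun x => v + x) ∘ fun x : E d => -v + x) = id := by ext x; simp
  rw [this, Measure.map_id]

variable {T : Type*} [MeasurableSpace T] {Φ : T → Set (E d) → ℂ}

lemma measurable_cellMeasure_apply (hΦ : IsRandomComplexMeasure Φ) (n : Fin d → ℤ)
    (B : Set (E d)) (hB : MeasurableSet B) :
    Measurable fun t => cellMeasure (hΦ.1 t) n B := by
  simp_rw [cellMeasure_apply _ _ hB]
  exact hΦ.2 _ ((isBounded_cell n).subset inter_subset_right) (hB.inter (measurableSet_cell n))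

theorem measurable_locVariation (hΦ : IsRandomComplexMeasure Φ) :
    Measurable fun t => locVariation (Φ t) := by
  simp_rw [locVariation_eq_sum (hΦ.1 _)]
  exact measurable_sum_measure fun n => measurable_variation (measurable_cellMeasure_apply hΦ n)

lemma measurable_posPartRe_cellMeasure (hΦ : IsRandomComplexMeasure Φ) (a : ℂ) (n : Fin d → ℤ) :
    Measurable fun t => posPartRe (a • cellMeasure (hΦ.1 t) n) :=
  measurable_posPartRe fun B hB => (measurable_cellMeasure_apply hΦ n B hB).const_smul a

theorem measurable_locPosPart (hΦ : IsRandomComplexMeasure Φ) (a : ℂ) :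
    Measurable fun t => locPosPart fun B => (a * Φ t B).re := by
  simp_rw [locPosPart_eq_sum (hΦ.1 _)]
  exact measurable_sum_measure fun n => measurable_posPartRe_cellMeasure hΦ a n

/-- The total variation of a random complex measure as a kernel. -/
def variationKernel (hΦ : IsRandomComplexMeasure Φ) : Kernel T (E d) :=
  ⟨fun t => locVariation (Φ t), measurable_locVariation hΦ⟩

instance (hΦ : IsRandomComplexMeasure Φ) : IsSFiniteKernel (variationKernel hΦ) :=
  isSFiniteKernel_of_eq_sum (ι := Fin d → ℤ) _
    (fun n => measurable_variation (measurable_cellMeasure_apply hΦ n)) (fun _ _ => inferInstance)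
    fun t => locVariation_eq_sum (hΦ.1 t)

/-- The positive part of the real part of `a Φ` as a kernel. -/
def posPartKernel (hΦ : IsRandomComplexMeasure Φ) (a : ℂ) : Kernel T (E d) :=
  ⟨fun t => locPosPart fun B => (a * Φ t B).re, measurable_locPosPart hΦ a⟩

instance (hΦ : IsRandomComplexMeasure Φ) (a : ℂ) : IsSFiniteKernel (posPartKernel hΦ a) :=
  isSFiniteKernel_of_eq_sum (ι := Fin d → ℤ) _
    (fun n => measurable_posPartRe_cellMeasure hΦ a n) (fun _ _ => inferInstance)
    fun t => locPosPart_eq_sum (hΦ.1 t) a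

end LocalCells

/-! ### Inequalities for squares in [0, ∞] -/

lemma two_mul_le_sq_add_sq (a b : ℝ≥0∞) : 2 * (a * b) ≤ a ^ 2 + b ^ 2 := by
  wlog h : a ≤ b generalizing a b
  · rw [mul_comm a, add_comm]
    exact this b a (le_of_not_ge h)
  obtain ⟨c, rfl⟩ := exists_add_of_le h
  calc 2 * (a * (a + c)) ≤ 2 * (a * (a + c)) + c ^ 2 := le_self_add
    _ = _ := by ring

lemma add_sq_le_two_mul (a b : ℝ≥0∞) : (a + b) ^ 2 ≤ 2 * a ^ 2 + 2 * b ^ 2 := by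
  calc (a + b) ^ 2 = a ^ 2 + b ^ 2 + 2 * (a * b) := by ring
    _ ≤ a ^ 2 + b ^ 2 + (a ^ 2 + b ^ 2) := by gcongr; exact two_mul_le_sq_add_sq a b
    _ = _ := by ring

/-- The Cauchy-Schwarz inequality with weights. -/
lemma tsum_sq_le_weighted {ι : Type*} {u : ι → ℝ≥0∞} (h0 : ∀ i, u i ≠ 0) (ht : ∀ i, u i ≠ ∞)
    (a : ι → ℝ≥0∞) :
    (∑' i, a i) ^ 2 ≤ (∑' i, (u i ^ 2)⁻¹) * ∑' i, (u i * a i) ^ 2 := by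
  -- Pairwise AM-GM for (u_i a_i)/u_j and (u_j a_j)/u_i; both terms on the right have the same
  -- double sum.
  have key : ∀ i j, 2 * (a i * a j) ≤
      (u j ^ 2)⁻¹ * (u i * a i) ^ 2 + (u i ^ 2)⁻¹ * (u j * a j) ^ 2 := by
    intro i j
    have e : ∀ i, u i * (u i)⁻¹ = 1 := fun i => ENNReal.mul_inv_cancel (h0 i) (ht i)
    have := two_mul_le_sq_add_sq ((u j)⁻¹ * (u i * a i)) ((u i)⁻¹ * (u j * a j))
    calc 2 * (a i * a j) = 2 * ((u j)⁻¹ * (u i * a i) * ((u i)⁻¹ * (u j * a j))) := by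
          rw [show (u j)⁻¹ * (u i * a i) * ((u i)⁻¹ * (u j * a j))
            = (u i * (u i)⁻¹) * (u j * (u j)⁻¹) * (a i * a j) by ring, e, e, one_mul, one_mul]
      _ ≤ _ := this
      _ = _ := by rw [mul_pow, mul_pow _ (u j * a j), ENNReal.inv_pow, ENNReal.inv_pow]
  have h2 : 2 * (∑' i, a i) ^ 2 ≤ 2 * ((∑' i, (u i ^ 2)⁻¹) * ∑' i, (u i * a i) ^ 2) := by
    calc 2 * (∑' i, a i) ^ 2 = ∑' i, ∑' j, 2 * (a i * a j) := by
          simp_rw [ENNReal.tsum_mul_left, ENNReal.tsum_mul_right]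
          rw [sq]
      _ ≤ ∑' i, ∑' j, ((u j ^ 2)⁻¹ * (u i * a i) ^ 2 + (u i ^ 2)⁻¹ * (u j * a j) ^ 2) :=
          ENNReal.tsum_le_tsum fun i => ENNReal.tsum_le_tsum fun j => key i j
      _ = _ := by
          simp_rw [ENNReal.tsum_add, ENNReal.tsum_mul_left, ENNReal.tsum_mul_right,
            ENNReal.tsum_mul_left]
          ring
  exact (ENNReal.mul_le_mul_iff_right (by simp) (by simp)).1 h2

lemma tsum_sq_le_sq_tsum {ι : Type*} (a : ι → ℝ≥0∞) : ∑' i, a i ^ 2 ≤ (∑' i, a i) ^ 2 := by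
  rw [sq, ← ENNReal.tsum_mul_right]
  refine ENNReal.tsum_le_tsum fun i => ?_
  rw [sq]
  gcongr
  exact ENNReal.le_tsum i

/-! ### Mass flow between cells and its invariance -/

section Flow

variable {d : ℕ} {Ω : Type*} [MeasurableSpace Ω] {P : Measure Ω}
  (M : Kernel Ω (E d)) (L : Kernel (Ω × E d) (E d))

/-- The mass which is transported from `cell n` into `cell m`. -/
def flow (n m : Fin d → ℤ) (ω : Ω) : ℝ≥0∞ :=
  ∫⁻ x in cell n, L (ω, x) (cell m) ∂M ω

lemma lintegral_eq_tsum_cell (ν : Measure (E d)) (f : E d → ℝ≥0∞) :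
    ∫⁻ x, f x ∂ν = ∑' n, ∫⁻ x in cell n, f x ∂ν := by
  conv_lhs => rw [← sum_restrict_cell ν]
  rw [lintegral_sum_measure]

lemma tsum_flow (m : Fin d → ℤ) (ω : Ω) :
    ∑' n, flow M L n m ω = ∫⁻ x, L (ω, x) (cell m) ∂M ω :=
  (lintegral_eq_tsum_cell _ _).symm

variable {M L}

lemma measurable_kernel_apply {B : Set (E d)} (hB : MeasurableSet B) (ω : Ω) :
    Measurable fun x => L (ω, x) B :=
  (L.measurable_coe hB).comp measurable_prodMk_left

lemma measurable_setLIntegral_kernel [IsSFiniteKernel M] {f : Ω × E d → ℝ≥0∞} (hf : Measurable f)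
    {Q : Set (E d)} (hQ : MeasurableSet Q) :
    Measurable fun ω => ∫⁻ x in Q, f (ω, x) ∂M ω := by
  have : ∀ ω, ∫⁻ x in Q, f (ω, x) ∂M ω = ∫⁻ x, (Prod.snd ⁻¹' Q).indicator f (ω, x) ∂M ω :=
    fun ω => by
      rw [← lintegral_indicator hQ]
      rfl
  simp_rw [this]
  exact (hf.indicator (measurable_snd hQ)).lintegral_kernel_prod_right'

lemma measurable_flow [IsSFiniteKernel M] (n m : Fin d → ℤ) : Measurable (flow M L n m) :=
  measurable_setLIntegral_kernel (L.measurable_coe (measurableSet_cell m)) (measurableSet_cell n)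

variable [AddAction (E d) Ω]

/-- Joint invariance of a random measure under translations. -/
def InvariantUnder (M : Kernel Ω (E d)) : Prop :=
  ∀ (v : E d) (ω : Ω), M (v +ᵥ ω) = (M ω).map fun x => v + x

/-- Joint invariance of a nonnegative transport kernel under translations. -/
def KernelInvariantUnder (L : Kernel (Ω × E d) (E d)) : Prop :=
  ∀ (v : E d) (ω : Ω) (x : E d), L (v +ᵥ ω, v + x) = (L (ω, x)).map fun y => v + y

lemma preimage_add_cell (k n : Fin d → ℤ) :
    (fun x : E d => latticePt k + x) ⁻¹' cell n = cell (n - k) := by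
  ext x
  simp only [mem_preimage, mem_cell, intPart_latticePt_add]
  exact eq_sub_iff_add_eq'.symm

lemma flow_vadd (hM : InvariantUnder M) (hL : KernelInvariantUnder L) (k n m : Fin d → ℤ) (ω : Ω) :
    flow M L n m (latticePt k +ᵥ ω) = flow M L (n - k) (m - k) ω := by
  unfold flow
  rw [hM, Measure.restrict_map (by fun_prop) (measurableSet_cell n), lintegral_map
    (measurable_kernel_apply (measurableSet_cell m) _) (by fun_prop), preimage_add_cell]
  refine lintegral_congr fun x => ?_
  rw [hL, Measure.map_apply (by fun_prop) (measurableSet_cell m), preimage_add_cell]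

lemma apply_cell_vadd (hM : InvariantUnder M) (k n : Fin d → ℤ) (ω : Ω) :
    M (latticePt k +ᵥ ω) (cell n) = M ω (cell (n - k)) := by
  rw [hM, Measure.map_apply (by fun_prop) (measurableSet_cell n), preimage_add_cell]

variable [MeasurableVAdd₂ (E d) Ω] [VAddInvariantMeasure (E d) Ω P]

lemma lintegral_vadd (v : E d) {f : Ω → ℝ≥0∞} (hf : Measurable f) :
    ∫⁻ ω, f (v +ᵥ ω) ∂P = ∫⁻ ω, f ω ∂P :=
  (measurePreserving_vadd v P).lintegral_comp hf

lemma exists_finset_cell_cover {B : Set (E d)} (hB : Bornology.IsBounded B) :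
    ∃ F : Finset (Fin d → ℤ), B ⊆ ⋃ n ∈ F, cell n := by
  obtain ⟨R, hR⟩ := hB.exists_norm_le
  refine ⟨(Set.finite_Icc (fun _ => ⌊-R⌋) (fun _ => ⌊R⌋)).toFinset, fun x hx => ?_⟩
  simp only [Finite.mem_toFinset, mem_iUnion, exists_prop]
  refine ⟨intPart x, ⟨fun i => ?_, fun i => ?_⟩, rfl⟩
  all_goals
    have h := (PiLp.norm_apply_le x i).trans (hR x hx)
    rw [Real.norm_eq_abs, abs_le] at h
    exact Int.floor_mono (by linarith)

/-- A lattice shift moves any target cell to cell 0, and a bounded set needs only finitely many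
target cells. -/
theorem locSquareIntegrable_of_tsum_flow [IsSFiniteKernel M] (hM : InvariantUnder M)
    (hL : KernelInvariantUnder L) (h : ∫⁻ ω, (∑' n, flow M L n 0 ω) ^ 2 ∂P < ∞)
    {B : Set (E d)} (hB : Bornology.IsBounded B) :
    ∫⁻ ω, (∫⁻ x, L (ω, x) B ∂M ω) ^ 2 ∂P < ∞ := by
  classical
  have hmT : ∀ m : Fin d → ℤ, Measurable fun ω => ∑' n, flow M L n m ω := fun m =>
    Measurable.tsum fun n => measurable_flow n m
  have hT : ∀ m : Fin d → ℤ, ∫⁻ ω, (∑' n, flow M L n m ω) ^ 2 ∂P < ∞ := by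
    intro m
    rw [← lintegral_vadd (P := P) (latticePt m) ((hmT m).pow_const 2)]
    simp_rw [flow_vadd hM hL, sub_self]
    convert h using 4 with ω
    exact (Equiv.subRight m).tsum_eq (fun n => flow M L n 0 ω)
  obtain ⟨F, hF⟩ := exists_finset_cell_cover hB
  have hle : ∀ ω, ∫⁻ x, L (ω, x) B ∂M ω ≤ ∑ m ∈ F, ∑' n, flow M L n m ω := by
    intro ω
    simp_rw [tsum_flow]
    rw [← lintegral_finsetSum' _ fun m _ =>
      (measurable_kernel_apply (measurableSet_cell m) ω).aemeasurable]
    exact lintegral_mono fun x => (measure_mono hF).trans (measure_biUnion_finset_le _ _)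
  refine (lintegral_mono fun ω => pow_le_pow_left₀ zero_le (hle ω) 2).trans_lt ?_
  clear hF hle
  induction F using Finset.induction_on with
  | empty => simp
  | insert m F hm ih =>
    simp_rw [Finset.sum_insert hm]
    refine (lintegral_mono fun ω => add_sq_le_two_mul _ _).trans_lt ?_
    rw [lintegral_add_left (((hmT m).pow_const 2).const_mul 2),
      lintegral_const_mul _ ((hmT m).pow_const 2), lintegral_const_mul']
    · exact ENNReal.add_lt_top.2 ⟨ENNReal.mul_lt_top (by simp) (hT m),
        ENNReal.mul_lt_top (by simp) ih⟩
    · simp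

/-- Cauchy-Schwarz removes the cross terms, so each remaining square can be shifted by its own
lattice vector, exchanging inflow into cell 0 for outflow from it. Bounding the sum of squares by
the square of the sum then reassembles a single integral over cell 0. -/
theorem tsum_flow_sq_lt_top_of_weights [IsSFiniteKernel M] (hM : InvariantUnder M)
    (hL : KernelInvariantUnder L) {u : (Fin d → ℤ) → ℝ≥0∞} (h0 : ∀ n, u n ≠ 0)
    (ht : ∀ n, u n ≠ ∞) (hu : ∑' n, (u n ^ 2)⁻¹ < ∞)
    (h : ∫⁻ ω, (∫⁻ x in cell 0, ∑' n, u n * L (ω, x) (cell (-n)) ∂M ω) ^ 2 ∂P < ∞) :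
    ∫⁻ ω, (∑' n, flow M L n 0 ω) ^ 2 ∂P < ∞ := by
  calc ∫⁻ ω, (∑' n, flow M L n 0 ω) ^ 2 ∂P
      ≤ ∫⁻ ω, (∑' n, (u n ^ 2)⁻¹) * ∑' n, (u n * flow M L n 0 ω) ^ 2 ∂P :=
        lintegral_mono fun ω => tsum_sq_le_weighted h0 ht _
    _ = (∑' n, (u n ^ 2)⁻¹) * ∑' n, ∫⁻ ω, (u n * flow M L n 0 ω) ^ 2 ∂P := by
        have hm : ∀ n, Measurable fun ω => (u n * flow M L n 0 ω) ^ 2 := fun n =>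
          ((measurable_flow n 0).const_mul _).pow_const 2
        rw [lintegral_const_mul _ (Measurable.tsum hm),
          lintegral_tsum fun n => (hm n).aemeasurable]
    _ = (∑' n, (u n ^ 2)⁻¹) * ∑' n, ∫⁻ ω, (u n * flow M L 0 (-n) ω) ^ 2 ∂P := by
        congr 2
        funext n
        rw [← lintegral_vadd (P := P) (latticePt n)
          (((measurable_flow n 0).const_mul (u n)).pow_const 2)]
        simp_rw [flow_vadd hM hL, sub_self, zero_sub]
    _ = (∑' n, (u n ^ 2)⁻¹) * ∫⁻ ω, ∑' n, (u n * flow M L 0 (-n) ω) ^ 2 ∂P := by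
        rw [lintegral_tsum fun n => (((measurable_flow 0 (-n)).const_mul _).pow_const 2).aemeasurable]
    _ ≤ (∑' n, (u n ^ 2)⁻¹) * ∫⁻ ω, (∑' n, u n * flow M L 0 (-n) ω) ^ 2 ∂P := by
        gcongr
        exact tsum_sq_le_sq_tsum _
    _ = (∑' n, (u n ^ 2)⁻¹) *
          ∫⁻ ω, (∫⁻ x in cell 0, ∑' n, u n * L (ω, x) (cell (-n)) ∂M ω) ^ 2 ∂P := by
        congr with ω
        rw [lintegral_tsum fun n =>
          ((measurable_kernel_apply (measurableSet_cell _) ω).const_mul _).aemeasurable]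
        congr with n
        rw [lintegral_const_mul _ (measurable_kernel_apply (measurableSet_cell _) ω)]
        rfl
    _ < ∞ := ENNReal.mul_lt_top hu h

end Flow

/-! ### Summable weights from a strongly log-dominating function -/

section Weights

variable {d : ℕ} {ρ : ℝ → ℝ}

/-- The function `r ↦ r^d ρ(r) + 1`, evaluated at the positive part of `r`. -/
def radialWeight (d : ℕ) (ρ : ℝ → ℝ) (r : ℝ) : ℝ := (max r 0) ^ d * ρ (max r 0) + 1

lemma radialWeight_of_nonneg {r : ℝ} (hr : 0 ≤ r) : radialWeight d ρ r = r ^ d * ρ r + 1 := by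
  rw [radialWeight, max_eq_left hr]

lemma one_le_radialWeight (hρ : StronglyLogDominating ρ) (r : ℝ) : 1 ≤ radialWeight d ρ r := by
  have := mul_nonneg (pow_nonneg (le_max_right r 0) d) (hρ.nonneg _ (le_max_right r 0))
  unfold radialWeight
  linarith

lemma radialWeight_mono (hρ : StronglyLogDominating ρ) : Monotone (radialWeight d ρ) := by
  intro r s hrs
  have h : max r 0 ≤ max s 0 := max_le_max hrs le_rfl
  unfold radialWeight
  have := hρ.mono (le_max_right r 0) (le_max_right s 0) h
  have := hρ.nonneg _ (le_max_right r 0)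
  gcongr

lemma one_div_radialWeight_antitone (hρ : StronglyLogDominating ρ) :
    Antitone fun r => 1 / radialWeight d ρ r := fun _ _ hrs =>
  one_div_le_one_div_of_le (zero_lt_one.trans_le (one_le_radialWeight hρ _))
    (radialWeight_mono hρ hrs)

/-- If ρ vanished identically, the integrand 1/(rρ(r)+1) would be 1 on the half-line; so ρ is
positive somewhere, and from there on by monotonicity. -/
lemma StronglyLogDominating.exists_one_le_mul (hρ : StronglyLogDominating ρ) :
    ∃ R : ℝ, 0 < R ∧ ∀ r, R ≤ r → 1 ≤ r * ρ r := by
  have hpos : ∃ r₀, 0 ≤ r₀ ∧ 0 < ρ r₀ := by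
    by_contra! hcon
    have h1 : ∀ r ∈ Ioi (0 : ℝ), 1 / (r * ρ r + 1) = 1 := fun r hr => by
      rw [le_antisymm (hcon r (le_of_lt hr)) (hρ.nonneg r (le_of_lt hr))]
      simp
    have h2 := (integrableOn_congr_fun h1 measurableSet_Ioi).1 hρ.integrable
    simp at h2
  obtain ⟨r₀, h₀, hr₀⟩ := hpos
  refine ⟨max r₀ (1 / ρ r₀), lt_max_of_lt_right (by positivity), fun r hr => ?_⟩
  have h1 : r₀ ≤ r := (le_max_left _ _).trans hr
  have h2 : 1 / ρ r₀ ≤ r := (le_max_right _ _).trans hr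
  have h3 : ρ r₀ ≤ ρ r := hρ.mono h₀ (h₀.trans h1) h1
  calc 1 = 1 / ρ r₀ * ρ r₀ := by field_simp
    _ ≤ r * ρ r := by gcongr; exact h₀.trans h1

lemma integrableOn_pow_mul_one_div_radialWeight (hd : 0 < d) (hρ : StronglyLogDominating ρ)
    (c : ℝ) :
    IntegrableOn (fun r => r ^ (d - 1) * (1 / radialWeight d ρ (r - c))) (Ioi 0) := by
  obtain ⟨R, hR, hRρ⟩ := hρ.exists_one_le_mul
  have hmeas : Measurable fun r => r ^ (d - 1) * (1 / radialWeight d ρ (r - c)) :=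
    (measurable_id.pow_const _).mul
      ((one_div_radialWeight_antitone hρ).measurable.comp (measurable_id.sub_const c))
  -- Beyond S both r/2 ≥ R and r - c ≥ r/2 hold. The shift c then costs only the factor 2^d, and the
  -- summand 1 is absorbed by (r/2)ρ(r/2).
  set S := max (2 * R) (2 * c)
  have hS : 0 < S := lt_max_of_lt_left (by positivity)
  rw [← Ioc_union_Ioi_eq_Ioi hS.le]
  refine IntegrableOn.union ?_ ?_
  · refine Measure.integrableOn_of_bounded (M := S ^ (d - 1)) (by simp) hmeas.aestronglyMeasurable ?_
    refine (ae_restrict_iff' measurableSet_Ioc).2 (ae_of_all _ fun r hr => ?_)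
    have h1 := one_le_radialWeight (d := d) hρ (r - c)
    have h2 : 1 / radialWeight d ρ (r - c) ≤ 1 := by
      rw [div_le_one (by linarith)]; exact h1
    rw [Real.norm_of_nonneg (mul_nonneg (pow_nonneg hr.1.le _) (by positivity))]
    calc r ^ (d - 1) * (1 / radialWeight d ρ (r - c)) ≤ r ^ (d - 1) * 1 := by
          gcongr; exact pow_nonneg hr.1.le _
      _ ≤ S ^ (d - 1) := by
          rw [mul_one]
          exact pow_le_pow_left₀ hr.1.le hr.2 _
  · have hint : IntegrableOn (fun r => 2 ^ d * (1 / (r / 2 * ρ (r / 2) + 1))) (Ioi S) := by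
      have h1 : IntegrableOn (fun r => 1 / (r / 2 * ρ (r / 2) + 1)) (Ioi 0) := by
        have := (integrableOn_Ioi_comp_mul_right_iff (fun r => 1 / (r * ρ r + 1)) 0
          (a := (1 / 2 : ℝ)) (by norm_num)).2 (by simpa using hρ.integrable)
        simpa only [mul_one_div] using this
      exact (h1.mono_set (Ioi_subset_Ioi hS.le)).const_mul _
    refine hint.mono' hmeas.aestronglyMeasurable ?_
    refine (ae_restrict_iff' measurableSet_Ioi).2 (ae_of_all _ fun r hr => ?_)
    have hr : S < r := hr
    have hr0 : 0 < r := hS.trans hr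
    have hrR : R ≤ r / 2 := by linarith [le_max_left (2 * R) (2 * c)]
    have hrc : r / 2 ≤ r - c := by linarith [le_max_right (2 * R) (2 * c)]
    have h1 := one_le_radialWeight (d := d) hρ (r - c)
    have h3 := hRρ _ hrR
    have h4 : (r / 2) ^ d * ρ (r / 2) ≤ radialWeight d ρ (r - c) := by
      refine le_trans ?_ (radialWeight_mono hρ hrc)
      rw [radialWeight_of_nonneg (by positivity)]
      linarith
    rw [Real.norm_of_nonneg (mul_nonneg (pow_nonneg hr0.le _) (by positivity)), mul_one_div,
      mul_one_div, div_le_div_iff₀ (by linarith) (by linarith)]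
    obtain ⟨e, rfl⟩ : ∃ e, d = e + 1 := ⟨d - 1, by omega⟩
    simp only [Nat.add_sub_cancel]
    calc r ^ e * (r / 2 * ρ (r / 2) + 1) ≤ r ^ e * (2 * (r / 2 * ρ (r / 2))) := by
          gcongr; linarith
      _ = 2 ^ (e + 1) * ((r / 2) ^ (e + 1) * ρ (r / 2)) := by
          rw [div_pow, pow_succ, pow_succ]; field_simp
      _ ≤ _ := by gcongr

lemma volume_cell (n : Fin d → ℤ) : volume (cell n : Set (E d)) = 1 := by
  have h : cell n = (WithLp.ofLp : E d → Fin d → ℝ) ⁻¹'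
      (univ.pi fun i => Ico (n i : ℝ) (n i + 1)) := by
    ext x
    simp only [mem_cell, mem_preimage, mem_univ_pi, mem_Ico, funext_iff, intPart, Int.floor_eq_iff]
  rw [h, (PiLp.volume_preserving_ofLp (Fin d)).measure_preimage
    (MeasurableSet.univ_pi fun _ => measurableSet_Ico).nullMeasurableSet, volume_pi_pi]
  simp

/-- Comparison with an integral in polar coordinates. A second √d is lost when the corner of a cell
is replaced by an arbitrary point of it. -/
lemma tsum_one_div_radialWeight_lt_top (hd : 0 < d) (hρ : StronglyLogDominating ρ) :
    ∑' n : Fin d → ℤ, ENNReal.ofReal (1 / radialWeight d ρ (‖(latticePt n : E d)‖ - √d)) < ∞ := by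
  have : Nonempty (Fin d) := ⟨⟨0, hd⟩⟩
  have hint : Integrable (fun x : E d => 1 / radialWeight d ρ (‖x‖ - 2 * √d)) := by
    have := (integrable_fun_norm_addHaar (volume : Measure (E d))
      (f := fun r => 1 / radialWeight d ρ (r - 2 * √d))).2
    simp only [finrank_euclideanSpace, Fintype.card_fin, smul_eq_mul] at this
    exact this (integrableOn_pow_mul_one_div_radialWeight hd hρ _)
  refine lt_of_le_of_lt ?_ hint.lintegral_lt_top
  rw [lintegral_eq_tsum_cell]
  refine ENNReal.tsum_le_tsum fun n => ?_
  calc _ = ∫⁻ x in cell n, ENNReal.ofReal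
        (1 / radialWeight d ρ (‖(latticePt n : E d)‖ - √d)) := by
        rw [setLIntegral_const, volume_cell, mul_one]
    _ ≤ _ := by
        refine setLIntegral_mono' (measurableSet_cell n) fun x hx => ?_
        refine ENNReal.ofReal_le_ofReal (one_div_radialWeight_antitone hρ ?_)
        have h1 := norm_sub_latticePt_le hx
        have h2 := norm_sub_norm_le x (latticePt n)
        linarith

/-- The weight by which the transport between cells with difference `n` is multiplied. -/
def cellWeight (ρ : ℝ → ℝ) (n : Fin d → ℤ) : ℝ≥0∞ :=
  ENNReal.ofReal √(radialWeight d ρ (‖(latticePt n : E d)‖ - √d))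

/-- All coordinates of n + (y - x) lie in (-1, 1). This is the reason for the √d in `cellWeight`:
the weight never exceeds the one at the true transport distance. -/
lemma norm_latticePt_sub_le {n : Fin d → ℤ} {x y : E d} (hx : x ∈ cell 0) (hy : y ∈ cell (-n)) :
    ‖(latticePt n : E d)‖ - √d ≤ ‖y - x‖ := by
  have h : ‖(latticePt n : E d) + (y - x)‖ ≤ √d := by
    have := norm_le_of_forall_abs_le (x := (latticePt n : E d) + (y - x)) (r := 1) zero_le_one
      fun i => by
        have h1 : ⌊x i⌋ = 0 := congrFun hx i
        have h2 : ⌊y i⌋ = -n i := congrFun hy i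
        rw [Int.floor_eq_iff] at h1 h2
        push_cast at h1 h2
        simp only [PiLp.add_apply, PiLp.sub_apply, latticePt]
        rw [abs_le]
        constructor <;> linarith [h1.1, h1.2, h2.1, h2.2]
    simpa using this
  have h3 := norm_sub_le (latticePt n + (y - x)) (y - x)
  rw [add_sub_cancel_right] at h3
  linarith

lemma tsum_cellWeight_mul_le (hρ : StronglyLogDominating ρ) (ν : Measure (E d)) {x : E d}
    (hx : x ∈ cell 0) :
    ∑' n, cellWeight ρ n * ν (cell (-n)) ≤
      ∫⁻ y, ENNReal.ofReal √(‖y - x‖ ^ d * ρ ‖y - x‖ + 1) ∂ν := by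
  rw [lintegral_eq_tsum_cell, ← (Equiv.neg (Fin d → ℤ)).tsum_eq fun n => ∫⁻ y in cell n, _ ∂ν]
  refine ENNReal.tsum_le_tsum fun n => ?_
  rw [← setLIntegral_const]
  refine setLIntegral_mono' (measurableSet_cell _) fun y hy => ?_
  refine ENNReal.ofReal_le_ofReal (Real.sqrt_le_sqrt ?_)
  rw [← radialWeight_of_nonneg (norm_nonneg (y - x))]
  exact radialWeight_mono hρ (norm_latticePt_sub_le hx hy)

variable {Ω : Type*} [MeasurableSpace Ω] {P : Measure Ω} {M : Kernel Ω (E d)}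
  {L : Kernel (Ω × E d) (E d)} [AddAction (E d) Ω] [MeasurableVAdd₂ (E d) Ω]
  [VAddInvariantMeasure (E d) Ω P]

theorem tsum_flow_sq_lt_top_of_stronglyLogDominating [IsSFiniteKernel M] (hd : 0 < d)
    (hM : InvariantUnder M) (hL : KernelInvariantUnder L) (hρ : StronglyLogDominating ρ)
    (h : ∫⁻ ω, (∫⁻ x in cell 0,
      ∫⁻ y, ENNReal.ofReal √(‖y - x‖ ^ d * ρ ‖y - x‖ + 1) ∂L (ω, x) ∂M ω) ^ 2 ∂P < ∞) :
    ∫⁻ ω, (∑' n, flow M L n 0 ω) ^ 2 ∂P < ∞ := by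
  have hpos : ∀ n : Fin d → ℤ, 0 < radialWeight d ρ (‖(latticePt n : E d)‖ - √d) := fun n =>
    zero_lt_one.trans_le (one_le_radialWeight hρ _)
  refine tsum_flow_sq_lt_top_of_weights hM hL (u := cellWeight ρ) (fun n => ?_)
    (fun n => ENNReal.ofReal_ne_top) ?_ ?_
  · exact (ENNReal.ofReal_pos.2 (Real.sqrt_pos.2 (hpos n))).ne'
  · convert tsum_one_div_radialWeight_lt_top hd hρ using 3 with n
    rw [cellWeight, ← ENNReal.ofReal_pow (Real.sqrt_nonneg _), Real.sq_sqrt (hpos n).le,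
      one_div, ENNReal.ofReal_inv_of_pos (hpos n)]
  · refine (lintegral_mono fun ω => ?_).trans_lt h
    exact pow_le_pow_left₀ zero_le (setLIntegral_mono' (measurableSet_cell 0)
      fun x hx => tsum_cellWeight_mul_le hρ _ hx) 2

end Weights

/-! ### Counting lattice points in boxes -/

section Boxes

variable {d : ℕ}

/-- The maximum norm of an integer point. -/
def supSize (n : Fin d → ℤ) : ℕ := Finset.univ.sup fun i => (n i).natAbs

/-- The integer points of maximum norm at most `k`. -/
def intBox (d k : ℕ) : Finset (Fin d → ℤ) := Finset.Icc (fun _ => -(k : ℤ)) fun _ => (k : ℤ)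

lemma mem_intBox {k : ℕ} {m : Fin d → ℤ} : m ∈ intBox d k ↔ supSize m ≤ k := by
  simp only [intBox, Finset.mem_Icc, Pi.le_def, supSize, Finset.sup_le_iff, Finset.mem_univ,
    true_implies, ← forall_and]
  exact forall_congr' fun i => by omega

lemma card_intBox (k : ℕ) : (intBox d k).card = (2 * k + 1) ^ d := by
  rw [intBox, Pi.card_Icc]
  simp only [Int.card_Icc, Finset.prod_const, Finset.card_univ, Fintype.card_fin]
  congr 1
  omega

/-- Each product a_n a_m is charged to the index of larger maximum norm, so that the other one
ranges over a finite box. -/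
lemma tsum_sq_le_tsum_intBox (a : (Fin d → ℤ) → ℝ≥0∞) :
    (∑' n, a n) ^ 2 ≤ 2 * ∑' n, a n * ∑ m ∈ intBox d (supSize n), a m := by
  classical
  set T : (Fin d → ℤ) → (Fin d → ℤ) → ℝ≥0∞ :=
    fun n m => if supSize m ≤ supSize n then a n * a m else 0
  have h1 : ∀ n, a n * ∑ m ∈ intBox d (supSize n), a m = ∑' m, T n m := by
    intro n
    rw [Finset.mul_sum, tsum_eq_sum (s := intBox d (supSize n))]
    · exact Finset.sum_congr rfl fun m hm => (if_pos (mem_intBox.1 hm)).symm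
    · exact fun m hm => if_neg fun h => hm (mem_intBox.2 h)
  have h2 : ∀ n m, a n * a m ≤ T n m + T m n := by
    intro n m
    rcases le_total (supSize m) (supSize n) with h | h
    · exact le_add_right (by simp [T, h])
    · exact le_add_left (by simp [T, h, mul_comm])
  simp_rw [h1]
  calc (∑' n, a n) ^ 2 = ∑' n, ∑' m, a n * a m := by
        simp_rw [ENNReal.tsum_mul_left, ENNReal.tsum_mul_right]
        rw [sq]
    _ ≤ ∑' n, ∑' m, (T n m + T m n) :=
        ENNReal.tsum_le_tsum fun n => ENNReal.tsum_le_tsum fun m => h2 n m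
    _ = 2 * ∑' n, ∑' m, T n m := by
        simp_rw [ENNReal.tsum_add]
        rw [ENNReal.tsum_comm (f := fun n m => T m n), two_mul]

lemma card_intBox_le_of_mem_cell {n e : Fin d → ℤ} (he : e ∈ Finset.Icc (0 : Fin d → ℤ) 1)
    {y : E d} (hy : y ∈ cell (-n - e)) :
    ((intBox d (supSize n)).card : ℝ≥0∞) ≤ 7 ^ d * (1 + ‖y‖ₑ ^ d) := by
  have h1 : (supSize n : ℝ) ≤ ‖y‖ + 2 := by
    have : supSize n ≤ ⌊‖y‖ + 2⌋₊ := by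
      refine Finset.sup_le fun i _ => Nat.le_floor ?_
      have h2 : ⌊y i⌋ = -n i - e i := congrFun hy i
      have he' := Finset.mem_Icc.1 he
      have h3 : (0 : ℤ) ≤ e i := he'.1 i
      have h4 : e i ≤ (1 : ℤ) := he'.2 i
      have h5 := PiLp.norm_apply_le y i
      rw [Real.norm_eq_abs, abs_le] at h5
      rw [Int.floor_eq_iff] at h2
      push_cast at h2
      have h3' : (0 : ℝ) ≤ e i := by exact_mod_cast h3
      have h4' : (e i : ℝ) ≤ 1 := by exact_mod_cast h4
      rw [Nat.cast_natAbs, Int.cast_abs, abs_le]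
      constructor <;> linarith [h2.1, h2.2, h5.1, h5.2]
    exact (Nat.cast_le.2 this).trans (Nat.floor_le (by positivity))
  have h2 : ((2 * supSize n + 1 : ℕ) : ℝ) ^ d ≤ 7 ^ d * (1 + ‖y‖ ^ d) := by
    -- Rounding and the offset e cost at most 1 each, so 2|n| + 1 ≤ 2‖y‖ + 5.
    have h3 : ((2 * supSize n + 1 : ℕ) : ℝ) ≤ 7 * max 1 ‖y‖ := by
      push_cast
      linarith [le_max_left 1 ‖y‖, le_max_right 1 ‖y‖]
    calc _ ≤ (7 * max 1 ‖y‖) ^ d := pow_le_pow_left₀ (by positivity) h3 d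
      _ = 7 ^ d * (max 1 ‖y‖) ^ d := mul_pow _ _ _
      _ ≤ _ := by
        gcongr
        rcases le_total 1 ‖y‖ with h | h
        · rw [max_eq_right h]; linarith
        · rw [max_eq_left h]; simp
  rw [card_intBox]
  calc (((2 * supSize n + 1) ^ d : ℕ) : ℝ≥0∞)
      = ENNReal.ofReal (((2 * supSize n + 1 : ℕ) : ℝ) ^ d) := by
        rw [← Nat.cast_pow, ENNReal.ofReal_natCast]
    _ ≤ ENNReal.ofReal (7 ^ d * (1 + ‖y‖ ^ d)) := ENNReal.ofReal_le_ofReal h2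
    _ = _ := by
        rw [ENNReal.ofReal_mul (by positivity), ENNReal.ofReal_add (by positivity) (by positivity),
          ENNReal.ofReal_pow (by positivity), ENNReal.ofReal_pow (by positivity), ofReal_norm]
        simp

lemma tsum_card_intBox_mul_le (ν : Measure (E d)) {e : Fin d → ℤ}
    (he : e ∈ Finset.Icc (0 : Fin d → ℤ) 1) :
    ∑' n, ((intBox d (supSize n)).card : ℝ≥0∞) * ν (cell (-n - e)) ≤
      7 ^ d * (ν univ + ∫⁻ y, ‖y‖ₑ ^ d ∂ν) := by
  have h : 7 ^ d * (ν univ + ∫⁻ y, ‖y‖ₑ ^ d ∂ν) = ∫⁻ y, 7 ^ d * (1 + ‖y‖ₑ ^ d) ∂ν := by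
    rw [lintegral_const_mul _ (by fun_prop), lintegral_add_left (by fun_prop)]
    simp
  rw [h, lintegral_eq_tsum_cell,
    ← ((Equiv.neg (Fin d → ℤ)).trans (Equiv.subRight e)).tsum_eq fun n => ∫⁻ y in cell n, _ ∂ν]
  refine ENNReal.tsum_le_tsum fun n => ?_
  rw [← setLIntegral_const]
  exact setLIntegral_mono' (measurableSet_cell _) fun y hy => card_intBox_le_of_mem_cell he hy

end Boxes

/-! ### Second moments of the inflow for decoupled kernels -/

section Independent

variable {d : ℕ} {Ω : Type*} [MeasurableSpace Ω] {P : Measure Ω} {M : Kernel Ω (E d)}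
  {L : Kernel (Ω × E d) (E d)} [AddAction (E d) Ω] [MeasurableVAdd₂ (E d) Ω]
  [VAddInvariantMeasure (E d) Ω P]

lemma lintegral_apply_cell_mul_le (hM : InvariantUnder M) (n m : Fin d → ℤ) :
    ∫⁻ ω, M ω (cell n) * M ω (cell m) ∂P ≤ ∫⁻ ω, M ω (cell 0) ^ 2 ∂P := by
  have hm : ∀ k, Measurable fun ω => M ω (cell k) := fun k =>
    M.measurable_coe (measurableSet_cell k)
  have hs : ∀ k, ∫⁻ ω, M ω (cell k) ^ 2 ∂P = ∫⁻ ω, M ω (cell 0) ^ 2 ∂P := fun k => by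
    rw [← lintegral_vadd (P := P) (latticePt k) ((hm k).pow_const 2)]
    simp_rw [apply_cell_vadd hM, sub_self]
  refine (ENNReal.mul_le_mul_iff_right (a := 2) (by simp) (by simp)).1 ?_
  have hmul : Measurable fun ω => M ω (cell n) * M ω (cell m) := (hm n).mul (hm m)
  rw [← lintegral_const_mul _ hmul]
  calc _ ≤ ∫⁻ ω, (M ω (cell n) ^ 2 + M ω (cell m) ^ 2) ∂P :=
        lintegral_mono fun ω => two_mul_le_sq_add_sq _ _
    _ = _ := by rw [lintegral_add_left ((hm n).pow_const 2), hs n, hs m, two_mul]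

/-- The expected mass transported from the origin into the cells close to `cell (-n)`. -/
def meanCellMass (P : Measure Ω) (L : Kernel (Ω × E d) (E d)) (n : Fin d → ℤ) : ℝ≥0∞ :=
  ∑ e ∈ Finset.Icc (0 : Fin d → ℤ) 1, ∫⁻ ω, L (ω, 0) (cell (-n - e)) ∂P

/-- Subtracting a coordinate of x, which lies in [0, 1), lowers the integer part by 0 or 1; hence
the 2^d offsets e. -/
lemma preimage_add_cell_subset {x : E d} (hx : x ∈ cell 0) (n : Fin d → ℤ) :
    (fun y => x + y) ⁻¹' cell (-n) ⊆ ⋃ e ∈ Finset.Icc (0 : Fin d → ℤ) 1, cell (-n - e) := by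
  intro y hy
  simp only [mem_iUnion, exists_prop]
  refine ⟨-n - intPart y, Finset.mem_Icc.2 ⟨fun i => ?_, fun i => ?_⟩, by simp [mem_cell]⟩
  all_goals
    have h1 : ⌊x i⌋ = 0 := congrFun hx i
    have h2 : ⌊x i + y i⌋ = -n i := congrFun hy i
    have h3 := Int.floor_le (y i)
    have h4 := Int.lt_floor_add_one (y i)
    rw [Int.floor_eq_iff] at h1 h2
    push_cast at h1 h2
    simp only [Pi.sub_apply, Pi.neg_apply, Pi.zero_apply, Pi.one_apply, intPart]
  · have : (⌊y i⌋ : ℝ) < -n i + 1 := by linarith [h1.1, h1.2, h2.1, h2.2]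
    have : ⌊y i⌋ < -n i + 1 := by exact_mod_cast this
    omega
  · have : (-n i : ℝ) < ⌊y i⌋ + 2 := by linarith [h1.1, h1.2, h2.1, h2.2]
    have : -n i < ⌊y i⌋ + 2 := by exact_mod_cast this
    omega

omit [AddAction (E d) Ω] [MeasurableVAdd₂ (E d) Ω] in
lemma measurable_kernel_apply_left {B : Set (E d)} (hB : MeasurableSet B) (x : E d) :
    Measurable fun ω => L (ω, x) B :=
  (L.measurable_coe hB).comp measurable_prodMk_right

/-- Here invariance is used for the non-lattice shift x: it moves the starting point to the origin,
at the price of the neighbouring cells, and gives a bound uniform in x. -/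
lemma lintegral_kernel_cell_le (hL : KernelInvariantUnder L) {x : E d} (hx : x ∈ cell 0)
    (n : Fin d → ℤ) : ∫⁻ ω, L (ω, x) (cell (-n)) ∂P ≤ meanCellMass P L n := by
  rw [← lintegral_vadd (P := P) x (measurable_kernel_apply_left (measurableSet_cell _) x),
    meanCellMass, ← lintegral_finsetSum _ fun e _ =>
      measurable_kernel_apply_left (measurableSet_cell _) 0]
  refine lintegral_mono fun ω => ?_
  have h := hL x ω 0
  rw [add_zero] at h
  rw [h, Measure.map_apply (by fun_prop) (measurableSet_cell _)]
  exact (measure_mono (preimage_add_cell_subset hx n)).trans (measure_biUnion_finset_le _ _)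

omit [AddAction (E d) Ω] [MeasurableVAdd₂ (E d) Ω] [VAddInvariantMeasure (E d) Ω P] in
lemma tsum_card_mul_meanCellMass_lt_top [IsProbabilityMeasure P] {b : ℝ≥0}
    (hb : ∀ p, L p univ ≤ b) (h : ∫⁻ ω, ∫⁻ x, ‖x‖ₑ ^ d ∂L (ω, 0) ∂P < ∞) :
    ∑' n, ((intBox d (supSize n)).card : ℝ≥0∞) * meanCellMass P L n < ∞ := by
  have hm : ∀ k, Measurable fun ω => L (ω, 0) (cell k) := fun k =>
    measurable_kernel_apply_left (measurableSet_cell _) 0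
  simp_rw [meanCellMass, Finset.mul_sum]
  rw [Summable.tsum_finsetSum fun _ _ => ENNReal.summable]
  refine ENNReal.sum_lt_top.2 fun e he => ?_
  calc ∑' n, ((intBox d (supSize n)).card : ℝ≥0∞) * ∫⁻ ω, L (ω, 0) (cell (-n - e)) ∂P
      = ∫⁻ ω, ∑' n, ((intBox d (supSize n)).card : ℝ≥0∞) * L (ω, 0) (cell (-n - e)) ∂P := by
        rw [lintegral_tsum fun n => ((hm _).const_mul _).aemeasurable]
        congr with n
        rw [lintegral_const_mul _ (hm _)]
    _ ≤ ∫⁻ ω, 7 ^ d * (b + ∫⁻ y, ‖y‖ₑ ^ d ∂L (ω, 0)) ∂P := by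
        refine lintegral_mono fun ω => (tsum_card_intBox_mul_le _ he).trans ?_
        gcongr
        exact hb _
    _ = 7 ^ d * (b + ∫⁻ ω, ∫⁻ y, ‖y‖ₑ ^ d ∂L (ω, 0) ∂P) := by
        rw [lintegral_const_mul' _ _ (by simp), lintegral_add_left measurable_const]
        simp
    _ < ∞ := ENNReal.mul_lt_top (by simp) (ENNReal.add_lt_top.2 ⟨by simp, h⟩)

/-- Only one flow of each product is kept; the other is bounded by b times the mass of its source
cell. The expectation is then linear in L, and `hdec` allows L to be replaced by its mean. -/
theorem tsum_flow_sq_lt_top_of_decoupled [IsProbabilityMeasure P] [IsSFiniteKernel M]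
    (hM : InvariantUnder M) (hL : KernelInvariantUnder L)
    (hMsq : ∫⁻ ω, M ω (cell 0) ^ 2 ∂P < ∞) {b : ℝ≥0} (hb : ∀ p, L p univ ≤ b)
    (hdec : ∀ n m k, ∫⁻ ω, flow M L n m ω * M ω (cell k) ∂P =
      ∫⁻ ω, (∫⁻ x in cell n, ∫⁻ ω', L (ω', x) (cell m) ∂P ∂M ω) * M ω (cell k) ∂P)
    (h : ∫⁻ ω, ∫⁻ x, ‖x‖ₑ ^ d ∂L (ω, 0) ∂P < ∞) :
    ∫⁻ ω, (∑' n, flow M L n 0 ω) ^ 2 ∂P < ∞ := by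
  have hmf := fun n => measurable_flow (M := M) (L := L) n 0
  have hmM : ∀ k, Measurable fun ω => M ω (cell k) := fun k =>
    M.measurable_coe (measurableSet_cell k)
  have hflow : ∀ n ω, flow M L n 0 ω ≤ b * M ω (cell n) := fun n ω => by
    rw [← setLIntegral_const]
    exact lintegral_mono fun x => (measure_mono (subset_univ _)).trans (hb _)
  have hpair : ∀ n m, ∫⁻ ω, flow M L n 0 ω * M ω (cell m) ∂P ≤
      meanCellMass P L n * ∫⁻ ω, M ω (cell 0) ^ 2 ∂P := by
    intro n m
    have hmul : Measurable fun ω => flow M L n 0 ω * M ω (cell m) := (hmf n).mul (hmM m)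
    -- Shifting the source to cell 0 makes the uniform bound on the mean kernel available.
    rw [← lintegral_vadd (P := P) (latticePt n) hmul]
    simp_rw [flow_vadd hM hL, apply_cell_vadd hM, sub_self, zero_sub]
    rw [hdec]
    calc _ ≤ ∫⁻ ω, meanCellMass P L n * (M ω (cell 0) * M ω (cell (m - n))) ∂P := by
          refine lintegral_mono fun ω => ?_
          rw [← mul_assoc]
          gcongr
          rw [← setLIntegral_const]
          exact setLIntegral_mono' (measurableSet_cell 0) fun x hx =>
            lintegral_kernel_cell_le hL hx n
      _ = meanCellMass P L n * ∫⁻ ω, M ω (cell 0) * M ω (cell (m - n)) ∂P :=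
          lintegral_const_mul _ ((hmM _).mul (hmM _))
      _ ≤ _ := mul_le_mul_right (lintegral_apply_cell_mul_le hM _ _) _
  have hmp : ∀ n m, Measurable fun ω => b * (flow M L n 0 ω * M ω (cell m)) := fun n m =>
    ((hmf n).mul (hmM m)).const_mul _
  calc ∫⁻ ω, (∑' n, flow M L n 0 ω) ^ 2 ∂P
      ≤ ∫⁻ ω, 2 * ∑' n, ∑ m ∈ intBox d (supSize n), b * (flow M L n 0 ω * M ω (cell m)) ∂P := by
        refine lintegral_mono fun ω => (tsum_sq_le_tsum_intBox _).trans ?_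
        refine mul_le_mul_right (ENNReal.tsum_le_tsum fun n => ?_) _
        rw [Finset.mul_sum]
        refine Finset.sum_le_sum fun m _ => ?_
        calc flow M L n 0 ω * flow M L m 0 ω ≤ flow M L n 0 ω * (b * M ω (cell m)) := by
              gcongr; exact hflow m ω
          _ = _ := by ring
    _ = 2 * ∑' n, ∑ m ∈ intBox d (supSize n), b * ∫⁻ ω, flow M L n 0 ω * M ω (cell m) ∂P := by
        rw [lintegral_const_mul' _ _ (by simp), lintegral_tsum fun n =>
          (Finset.measurable_fun_sum _ fun m _ => hmp n m).aemeasurable]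
        congr with n
        rw [lintegral_finsetSum _ fun m _ => hmp n m]
        refine Finset.sum_congr rfl fun m _ => ?_
        rw [lintegral_const_mul' _ _ (by simp)]
    _ ≤ 2 * ∑' n, ∑ m ∈ intBox d (supSize n),
          b * (meanCellMass P L n * ∫⁻ ω, M ω (cell 0) ^ 2 ∂P) := by
        gcongr with n m
        exact hpair n m
    _ = 2 * ((∑' n, ((intBox d (supSize n)).card : ℝ≥0∞) * meanCellMass P L n) *
          (b * ∫⁻ ω, M ω (cell 0) ^ 2 ∂P)) := by
        rw [← ENNReal.tsum_mul_right]
        congr with n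
        rw [Finset.sum_const, nsmul_eq_mul]
        ring
    _ < ∞ := ENNReal.mul_lt_top (by simp) (ENNReal.mul_lt_top
        (tsum_card_mul_meanCellMass_lt_top (P := P) hb h) (ENNReal.mul_lt_top (by simp) hMsq))

end Independent

/-! ### Replacing an independent kernel by its mean -/

section Decoupling

variable {Ω Ω₁ Ω₂ X : Type*} [MeasurableSpace Ω] [MeasurableSpace Ω₁] [MeasurableSpace Ω₂]
  [MeasurableSpace X]

lemma lintegral_comp_indepFun {P : Measure Ω} [IsProbabilityMeasure P] {f : Ω → Ω₁} {g : Ω → Ω₂}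
    (hf : Measurable f) (hg : Measurable g) (h : IndepFun f g P) {F : Ω₁ × Ω₂ → ℝ≥0∞}
    (hF : Measurable F) :
    ∫⁻ ω, F (f ω, g ω) ∂P = ∫⁻ ω, ∫⁻ ω', F (f ω', g ω) ∂P ∂P := by
  have : IsProbabilityMeasure (P.map f) := Measure.isProbabilityMeasure_map hf.aemeasurable
  have : IsProbabilityMeasure (P.map g) := Measure.isProbabilityMeasure_map hg.aemeasurable
  have h1 := (indepFun_iff_map_prod_eq_prod_map_map hf.aemeasurable hg.aemeasurable).1 h
  rw [← lintegral_map (f := F) hF (hf.prodMk hg), h1, lintegral_prod_symm _ hF.aemeasurable,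
    lintegral_map hF.lintegral_prod_left' hg]
  refine lintegral_congr fun ω => ?_
  exact lintegral_map (f := fun x => F (x, g ω)) (hF.comp measurable_prodMk_right) hf

lemma measurable_setLIntegral_prod (M : Kernel Ω₂ X) [IsSFiniteKernel M] {f : Ω₁ × X → ℝ≥0∞}
    (hf : Measurable f) {Q : Set X} (hQ : MeasurableSet Q) :
    Measurable fun p : Ω₁ × Ω₂ => ∫⁻ x in Q, f (p.1, x) ∂M p.2 := by
  have : ∀ p : Ω₁ × Ω₂, ∫⁻ x in Q, f (p.1, x) ∂M p.2 =
      ∫⁻ x, (Prod.snd ⁻¹' Q).indicator (fun q : (Ω₁ × Ω₂) × X => f (q.1.1, q.2)) (p, x)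
        ∂(M.prodMkLeft Ω₁) p := fun p => by
    rw [← lintegral_indicator hQ, Kernel.prodMkLeft_apply]
    rfl
  simp_rw [this]
  exact Measurable.lintegral_kernel_prod_right'
    ((hf.comp (by fun_prop)).indicator (measurable_snd hQ))

/-- The joint law of f and g is a product, so f can be integrated out with g fixed; Tonelli moves
this expectation inside the integral against M. -/
lemma lintegral_decoupled {P : Measure Ω} [IsProbabilityMeasure P] {f : Ω → Ω₁} {g : Ω → Ω₂}
    (hf : Measurable f) (hg : Measurable g) (h : IndepFun f g P) (M : Kernel Ω₂ X)
    [IsSFiniteKernel M] {ℓ : Ω₁ × X → ℝ≥0∞} (hℓ : Measurable ℓ) {Q Q' : Set X}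
    (hQ : MeasurableSet Q) (hQ' : MeasurableSet Q') :
    ∫⁻ ω, (∫⁻ x in Q, ℓ (f ω, x) ∂M (g ω)) * M (g ω) Q' ∂P =
      ∫⁻ ω, (∫⁻ x in Q, ∫⁻ ω', ℓ (f ω', x) ∂P ∂M (g ω)) * M (g ω) Q' ∂P := by
  have hm := measurable_setLIntegral_prod (Ω₁ := Ω₁) M hℓ hQ
  rw [lintegral_comp_indepFun hf hg h
    (F := fun p => (∫⁻ x in Q, ℓ (p.1, x) ∂M p.2) * M p.2 Q')
    (hm.mul ((M.measurable_coe hQ').comp measurable_snd))]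
  refine lintegral_congr fun ω => ?_
  have hm' : Measurable fun ω' => ∫⁻ x in Q, ℓ (f ω', x) ∂M (g ω) :=
    hm.comp (hf.prodMk measurable_const)
  dsimp only
  rw [lintegral_mul_const _ hm', lintegral_lintegral_swap]
  have : Measurable (Function.uncurry fun (ω' : Ω) (x : X) => ℓ (f ω', x)) :=
    hℓ.comp ((hf.comp measurable_fst).prodMk measurable_snd)
  exact this.aemeasurable

end Decoupling

/-! ### The destination measure and the two integrability conditions -/

section Assembly

variable {d : ℕ} {Ω : Type*} [mΩ : MeasurableSpace Ω] {P : Measure Ω}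
  {Φ : Ω → Set (E d) → ℂ} {K : Ω → E d → ComplexMeasure (E d)}

/-- The variation of a random transport kernel, as a kernel. -/
def transportVariation (hK : IsTransportKernel K) : Kernel (Ω × E d) (E d) :=
  ⟨fun p => (K p.1 p.2).variation, measurable_variation (c := fun p : Ω × E d => K p.1 p.2) hK⟩

lemma measurable_posPartRe_transport (hK : IsTransportKernel K) (a : ℂ) (ω : Ω) :
    Measurable fun x => posPartRe (a • K ω x) :=
  measurable_posPartRe fun B hB => ((hK B hB).comp measurable_prodMk_left).const_smul a

lemma measurable_variation_transport (hK : IsTransportKernel K) (ω : Ω) :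
    Measurable fun x => (K ω x).variation :=
  measurable_variation fun B hB => (hK B hB).comp measurable_prodMk_left

lemma absDestination_apply (hK : IsTransportKernel K) (ω : Ω) {B : Set (E d)}
    (hB : MeasurableSet B) :
    absDestination K Φ ω B = ∫⁻ x, (K ω x).variation B ∂locVariation (Φ ω) :=
  Measure.bind_apply hB (measurable_variation_transport hK ω).aemeasurable

lemma measurable_absDestination_apply (hΦ : IsRandomComplexMeasure Φ) (hK : IsTransportKernel K)
    {B : Set (E d)} (hB : MeasurableSet B) : Measurable fun ω => absDestination K Φ ω B := by
  simp_rw [absDestination_apply hK _ hB]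
  exact Measurable.lintegral_kernel_prod_right' (κ := variationKernel hΦ)
    ((transportVariation hK).measurable_coe hB)

lemma isLocallyFiniteMeasure_iff_ball (ν : Measure (E d)) :
    IsLocallyFiniteMeasure ν ↔ ∀ n : ℕ, ν (Metric.ball 0 n) < ∞ := by
  refine ⟨fun h n => Metric.isBounded_ball.measure_lt_top, fun h => ⟨fun x => ?_⟩⟩
  obtain ⟨n, hn⟩ := exists_nat_gt ‖x‖
  exact ⟨Metric.ball 0 n, Metric.isOpen_ball.mem_nhds (by simpa using hn), h n⟩

lemma locIntegral_eq (μ : Set (E d) → ℂ) (f : E d → ℂ) :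
    locIntegral μ f = (∫ x, f x ∂(locPosPart fun B => (1 * μ B).re))
      - (∫ x, f x ∂(locPosPart fun B => (-1 * μ B).re)) +
      Complex.I * ((∫ x, f x ∂(locPosPart fun B => (-Complex.I * μ B).re))
        - (∫ x, f x ∂(locPosPart fun B => (Complex.I * μ B).re))) := by
  simp [locIntegral]

/-- The part of the destination coming from given Jordan components. -/
def partialDestination (K : Ω → E d → ComplexMeasure (E d)) (Φ : Ω → Set (E d) → ℂ) (ω : Ω)
    (a b : ℂ) : Measure (E d) :=
  (locPosPart fun B => (a * Φ ω B).re).bind fun x => posPartRe (b • K ω x)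

lemma partialDestination_apply (hK : IsTransportKernel K) (ω : Ω) (a b : ℂ) {B : Set (E d)}
    (hB : MeasurableSet B) : partialDestination K Φ ω a b B =
      ∫⁻ x, posPartRe (b • K ω x) B ∂(locPosPart fun B => (a * Φ ω B).re) :=
  Measure.bind_apply hB (measurable_posPartRe_transport hK b ω).aemeasurable

lemma partialDestination_le (hΦ : IsRandomComplexMeasure Φ) (hK : IsTransportKernel K) (ω : Ω)
    {a b : ℂ} (ha : ‖a‖ = 1) (hb : ‖b‖ = 1) :
    partialDestination K Φ ω a b ≤ absDestination K Φ ω := by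
  refine Measure.le_intro fun B hB _ => ?_
  rw [partialDestination_apply hK ω a b hB, absDestination_apply hK ω hB]
  exact lintegral_mono' (locPosPart_le_locVariation (hΦ.1 ω) ha) fun x =>
    posPartRe_smul_le_variation hb _ B

lemma isLocallyFiniteMeasure_partialDestination (hΦ : IsRandomComplexMeasure Φ)
    (hK : IsTransportKernel K) {ω : Ω} (h : IsLocallyFiniteMeasure (absDestination K Φ ω))
    {a b : ℂ} (ha : ‖a‖ = 1) (hb : ‖b‖ = 1) :
    IsLocallyFiniteMeasure (partialDestination K Φ ω a b) :=
  Measure.isLocallyFiniteMeasure_of_le (partialDestination_le hΦ hK ω ha hb)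

/-- The integrand is split into its Jordan components; each has a finite integral because the
corresponding part of the destination is dominated by |K||Φ|. -/
lemma integral_kernel_locPosPart (hΦ : IsRandomComplexMeasure Φ) (hK : IsTransportKernel K) {ω : Ω}
    (h : IsLocallyFiniteMeasure (absDestination K Φ ω)) {a : ℂ} (ha : ‖a‖ = 1) {B : Set (E d)}
    (hB : Bornology.IsBounded B) (hBm : MeasurableSet B) :
    ∫ x, K ω x B ∂(locPosPart fun B => (a * Φ ω B).re) =
      (((partialDestination K Φ ω a 1).real B - (partialDestination K Φ ω a (-1)).real B : ℝ) : ℂ)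
      + Complex.I * (((partialDestination K Φ ω a (-Complex.I)).real B
        - (partialDestination K Φ ω a Complex.I).real B : ℝ) : ℂ) := by
  have hm : ∀ b, AEMeasurable (fun x => posPartRe (b • K ω x) B)
      (locPosPart fun B => (a * Φ ω B).re) := fun b =>
    ((Measure.measurable_coe hBm).comp (measurable_posPartRe_transport hK b ω)).aemeasurable
  have hfin : ∀ b : ℂ, ‖b‖ = 1 → ∫⁻ x, posPartRe (b • K ω x) B
      ∂(locPosPart fun B => (a * Φ ω B).re) ≠ ∞ := fun b hb => by
    rw [← partialDestination_apply hK ω a b hBm]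
    have := isLocallyFiniteMeasure_partialDestination hΦ hK h ha hb
    exact hB.measure_lt_top.ne
  have hint : ∀ b : ℂ, ‖b‖ = 1 → Integrable (fun x => (posPartRe (b • K ω x)).real B)
      (locPosPart fun B => (a * Φ ω B).re) := fun b hb =>
    integrable_toReal_of_lintegral_ne_top (hm b) (hfin b hb)
  have hval : ∀ b : ℂ, ‖b‖ = 1 → ∫ x, (posPartRe (b • K ω x)).real B
      ∂(locPosPart fun B => (a * Φ ω B).re) = (partialDestination K Φ ω a b).real B := fun b hb => by
    simp only [measureReal_def]
    rw [integral_toReal (hm b) (ae_of_all _ fun x => measure_lt_top _ _),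
      partialDestination_apply hK ω a b hBm]
  have h1 : ‖(1 : ℂ)‖ = 1 := by simp
  have h2 : ‖(-1 : ℂ)‖ = 1 := by simp
  have h3 : ‖(-Complex.I : ℂ)‖ = 1 := by simp
  have h4 : ‖(Complex.I : ℂ)‖ = 1 := by simp
  rw [← hval _ h1, ← hval _ h2, ← hval _ h3, ← hval _ h4, ← integral_sub (hint _ h1) (hint _ h2),
    ← integral_sub (hint _ h3) (hint _ h4), ← integral_complex_ofReal, ← integral_complex_ofReal,
    ← integral_const_mul, ← integral_add]
  · refine integral_congr_ae (ae_of_all _ fun x => ?_)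
    have h5 : (-1 : ℂ) • K ω x = -K ω x := by ext; simp
    simpa [h5] using apply_eq_posPartRe (K ω x) hBm
  · exact ((hint _ h1).sub (hint _ h2)).ofReal
  · exact ((hint _ h3).sub (hint _ h4)).ofReal.const_mul _

lemma isLocComplexMeasure_destination (hΦ : IsRandomComplexMeasure Φ) (hK : IsTransportKernel K)
    (ω : Ω) : IsLocComplexMeasure (destination K Φ ω) := by
  by_cases h : IsLocallyFiniteMeasure (absDestination K Φ ω)
  · have h1 : ‖(1 : ℂ)‖ = 1 := by simp
    have h2 : ‖(-1 : ℂ)‖ = 1 := by simp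
    have h3 : ‖(-Complex.I : ℂ)‖ = 1 := by simp
    have h4 : ‖(Complex.I : ℂ)‖ = 1 := by simp
    have f := fun {a b : ℂ} (ha : ‖a‖ = 1) (hb : ‖b‖ = 1) =>
      isLocallyFiniteMeasure_partialDestination hΦ hK h ha hb
    have f11 := f h1 h1
    have f12 := f h1 h2
    have f13 := f h1 h3
    have f14 := f h1 h4
    have f21 := f h2 h1
    have f22 := f h2 h2
    have f23 := f h2 h3
    have f24 := f h2 h4
    have f31 := f h3 h1
    have f32 := f h3 h2
    have f33 := f h3 h3
    have f34 := f h3 h4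
    have f41 := f h4 h1
    have f42 := f h4 h2
    have f43 := f h4 h3
    have f44 := f h4 h4
    have hadd : ∀ ν₁ ν₂ ν₃ ν₄ : Measure (E d), IsLocallyFiniteMeasure ν₁ →
        IsLocallyFiniteMeasure ν₂ → IsLocallyFiniteMeasure ν₃ → IsLocallyFiniteMeasure ν₄ →
        IsLocallyFiniteMeasure (ν₁ + ν₂ + ν₃ + ν₄) := fun ν₁ ν₂ ν₃ ν₄ g₁ g₂ g₃ g₄ => by
      rw [isLocallyFiniteMeasure_iff_ball] at g₁ g₂ g₃ g₄ ⊢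
      intro n
      simp [g₁ n, g₂ n, g₃ n, g₄ n]
    have hreal : ∀ (ν₁ ν₂ ν₃ ν₄ : Measure (E d)) (B : Set (E d)), Bornology.IsBounded B →
        IsLocallyFiniteMeasure ν₁ →
        IsLocallyFiniteMeasure ν₂ → IsLocallyFiniteMeasure ν₃ → IsLocallyFiniteMeasure ν₄ →
        (ν₁ + ν₂ + ν₃ + ν₄).real B = ν₁.real B + ν₂.real B + ν₃.real B + ν₄.real B :=
      fun ν₁ ν₂ ν₃ ν₄ B hB g₁ g₂ g₃ g₄ => by
        have t₁ : ν₁ B ≠ ∞ := hB.measure_lt_top.ne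
        have t₂ : ν₂ B ≠ ∞ := hB.measure_lt_top.ne
        have t₃ : ν₃ B ≠ ∞ := hB.measure_lt_top.ne
        have t₄ : ν₄ B ≠ ∞ := hB.measure_lt_top.ne
        rw [measureReal_add_apply (by simp [t₁, t₂, t₃]) t₄,
          measureReal_add_apply (by simp [t₁, t₂]) t₃, measureReal_add_apply t₁ t₂]
    -- The part with factors a and b enters KΦ with coefficient conj(ab). The sixteen parts are
    -- grouped by ab = 1, -1, -i, i.
    refine ⟨_, _, _, _, hadd _ _ _ _ f11 f22 f34 f43, hadd _ _ _ _ f12 f21 f33 f44,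
      hadd _ _ _ _ f13 f24 f31 f42, hadd _ _ _ _ f14 f23 f32 f41, fun B hB hBm => ?_⟩
    rw [hreal _ _ _ _ B hB f11 f22 f34 f43, hreal _ _ _ _ B hB f12 f21 f33 f44,
      hreal _ _ _ _ B hB f13 f24 f31 f42, hreal _ _ _ _ B hB f14 f23 f32 f41]
    simp only [destination, if_pos h, locIntegral_eq]
    rw [integral_kernel_locPosPart hΦ hK h h1 hB hBm, integral_kernel_locPosPart hΦ hK h h2 hB hBm,
      integral_kernel_locPosPart hΦ hK h h3 hB hBm, integral_kernel_locPosPart hΦ hK h h4 hB hBm]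
    apply Complex.ext <;> simp <;> ring
  · refine ⟨0, 0, 0, 0, inferInstance, inferInstance, inferInstance, inferInstance,
      fun B _ _ => ?_⟩
    simp [destination, if_neg h]

lemma measurable_destination_apply (hΦ : IsRandomComplexMeasure Φ) (hK : IsTransportKernel K)
    {B : Set (E d)} (hBm : MeasurableSet B) : Measurable fun ω => destination K Φ ω B := by
  classical
  have hS : MeasurableSet {ω | IsLocallyFiniteMeasure (absDestination K Φ ω)} := by
    simp_rw [isLocallyFiniteMeasure_iff_ball, Set.ofPred_forall]
    exact MeasurableSet.iInter fun n => measurableSet_lt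
      (measurable_absDestination_apply hΦ hK Metric.isOpen_ball.measurableSet) measurable_const
  refine Measurable.ite hS ?_ measurable_const
  simp_rw [locIntegral_eq]
  have hm : ∀ a : ℂ, Measurable fun ω =>
      ∫ x, K ω x B ∂(locPosPart fun B => (a * Φ ω B).re) := fun a =>
    (StronglyMeasurable.integral_kernel_prod_right' (κ := posPartKernel hΦ a)
      (hK B hBm).stronglyMeasurable).measurable
  exact ((hm _).sub (hm _)).add (((hm _).sub (hm _)).const_mul _)

lemma enorm_destination_le (hΦ : IsRandomComplexMeasure Φ) (hK : IsTransportKernel K) (ω : Ω)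
    {B : Set (E d)} (hBm : MeasurableSet B) :
    ‖destination K Φ ω B‖ₑ ≤ 4 * absDestination K Φ ω B := by
  unfold destination
  split_ifs
  · have hb : ∀ a : ℂ, ‖a‖ = 1 → ‖∫ x, K ω x B ∂(locPosPart fun B => (a * Φ ω B).re)‖ₑ ≤
        absDestination K Φ ω B := fun a ha => by
      rw [absDestination_apply hK ω hBm]
      exact (enorm_integral_le_lintegral_enorm _).trans
        (lintegral_mono' (locPosPart_le_locVariation (hΦ.1 ω) ha) fun x =>
          (K ω x).enorm_measure_le_variation B)
    rw [locIntegral_eq]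
    refine (enorm_add_le _ _).trans ?_
    rw [enorm_mul, ← ofReal_norm Complex.I, Complex.norm_I, ENNReal.ofReal_one, one_mul]
    refine (add_le_add enorm_sub_le enorm_sub_le).trans ?_
    refine (add_le_add (add_le_add (hb _ (by simp)) (hb _ (by simp)))
      (add_le_add (hb _ (by simp)) (hb _ (by simp)))).trans (le_of_eq ?_)
    ring
  · simp

lemma locVariation_destination_le (hΦ : IsRandomComplexMeasure Φ) (hK : IsTransportKernel K)
    (ω : Ω) : locVariation (destination K Φ ω) ≤ (4 : ℝ≥0∞) • absDestination K Φ ω :=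
  sInf_le fun _ _ hBm => enorm_destination_le hΦ hK ω hBm

theorem destination_of_locSquareIntegrable [IsProbabilityMeasure P]
    (hΦ : IsRandomComplexMeasure Φ) (hK : IsTransportKernel K)
    (h : LocSquareIntegrable P (absDestination K Φ)) :
    (∀ᵐ ω ∂P, IsLocallyFiniteMeasure (absDestination K Φ ω)) ∧
      IsRandomComplexMeasure (destination K Φ) ∧ LocAbsSquareIntegrable P (destination K Φ) := by
  refine ⟨?_, ⟨isLocComplexMeasure_destination hΦ hK, fun B _ hBm =>
    measurable_destination_apply hΦ hK hBm⟩, fun B hB hBm => ?_⟩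
  · simp_rw [isLocallyFiniteMeasure_iff_ball, ae_all_iff]
    intro n
    have hm : MeasurableSet (Metric.ball (0 : E d) n) := Metric.isOpen_ball.measurableSet
    have := ae_lt_top ((measurable_absDestination_apply hΦ hK hm).pow_const 2)
      (h _ Metric.isBounded_ball hm).ne
    filter_upwards [this] with ω hω
    exact lt_top_iff_ne_top.2 fun ht => by simp [ht] at hω
  · calc ∫⁻ ω, locVariation (destination K Φ ω) B ^ 2 ∂P
        ≤ ∫⁻ ω, 16 * absDestination K Φ ω B ^ 2 ∂P := by
          refine lintegral_mono fun ω => ?_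
          refine (pow_le_pow_left₀ zero_le (locVariation_destination_le hΦ hK ω B) 2).trans ?_
          rw [Measure.smul_apply, smul_eq_mul, mul_pow]
          norm_num
      _ = 16 * ∫⁻ ω, absDestination K Φ ω B ^ 2 ∂P := lintegral_const_mul' _ _ (by simp)
      _ < ∞ := ENNReal.mul_lt_top (by simp) (h B hB hBm)

variable [AddAction (E d) Ω]

lemma invariantUnder_variationKernel (hΦ : IsRandomComplexMeasure Φ) (h : IsInvariantMeasure Φ) :
    InvariantUnder (variationKernel hΦ) := fun v ω =>
  locVariation_eq_map_add (hΦ.1 ω) (hΦ.1 (v +ᵥ ω)) (h v ω)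

lemma kernelInvariantUnder_transportVariation (hK : IsTransportKernel K)
    (h : IsInvariantKernel K) : KernelInvariantUnder (transportVariation hK) := fun v ω x => by
  have e : K (v +ᵥ ω) (v + x) = (K ω x).map fun y => v + y := by
    ext B hB
    rw [VectorMeasure.map_apply _ (by fun_prop) hB]
    have hp : (fun y => v + y) ⁻¹' B = -v +ᵥ B := by
      ext y; simp [mem_vadd_set_iff_neg_vadd_mem]
    have := h v ω x (-v +ᵥ B) (hB.const_vadd (-v))
    rw [vadd_vadd, add_neg_cancel, zero_vadd] at this
    rw [hp, ← this]
    rfl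
  have he : MeasurableEmbedding fun y : E d => v + y :=
    (MeasurableEquiv.addLeft v).measurableEmbedding
  change (K (v +ᵥ ω) (v + x)).variation = ((K ω x).variation).map _
  rw [e, he.variation_map]

omit mΩ [AddAction (E d) Ω] in
lemma lintegral_relKernel_variation (ω : Ω) (x : E d) (f : E d → ℝ≥0∞) :
    ∫⁻ y, f y ∂(relKernel K ω x).variation = ∫⁻ y, f (y - x) ∂(K ω x).variation := by
  have he : MeasurableEmbedding fun y : E d => y - x :=
    (MeasurableEquiv.subRight x).measurableEmbedding
  rw [relKernel, he.variation_map, he.lintegral_map]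

variable [MeasurableVAdd₂ (E d) Ω] [VAddInvariantMeasure (E d) Ω P]

lemma locSquareIntegrable_absDestination (hΦ : IsRandomComplexMeasure Φ)
    (hΦinv : IsInvariantMeasure Φ) (hK : IsTransportKernel K) (hKinv : IsInvariantKernel K)
    (h : ∫⁻ ω, (∑' n, flow (variationKernel hΦ) (transportVariation hK) n 0 ω) ^ 2 ∂P < ∞) :
    LocSquareIntegrable P (absDestination K Φ) := fun B hB hBm => by
  have := locSquareIntegrable_of_tsum_flow (invariantUnder_variationKernel hΦ hΦinv)
    (kernelInvariantUnder_transportVariation hK hKinv) h hB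
  simp_rw [absDestination_apply hK _ hBm]
  exact this

theorem tsum_flow_sq_lt_top_of_generalCondition (hd : 0 < d) (hΦ : IsRandomComplexMeasure Φ)
    (hΦinv : IsInvariantMeasure Φ) (hK : IsTransportKernel K) (hKinv : IsInvariantKernel K)
    (h : GeneralCondition P K Φ) :
    ∫⁻ ω, (∑' n, flow (variationKernel hΦ) (transportVariation hK) n 0 ω) ^ 2 ∂P < ∞ := by
  obtain ⟨ρ, hρ, hsq⟩ := h
  refine tsum_flow_sq_lt_top_of_stronglyLogDominating hd (invariantUnder_variationKernel hΦ hΦinv)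
    (kernelInvariantUnder_transportVariation hK hKinv) hρ ?_
  have := hsq (cell 0) (isBounded_cell 0) (measurableSet_cell 0)
  simp_rw [weightedSource, withDensity_apply _ (measurableSet_cell (0 : Fin d → ℤ)),
    lintegral_relKernel_variation] at this
  exact this

omit [AddAction (E d) Ω] [MeasurableVAdd₂ (E d) Ω] [VAddInvariantMeasure (E d) Ω P] in
-- Decoupling is applied to the identity of Ω twice, with target σ-field 𝒢 for K and σ(Φ) for Φ.
-- Measurability of the variations holds over these smaller σ-fields as well.
lemma lintegral_flow_mul_of_indepKernel [IsProbabilityMeasure P] (hΦ : IsRandomComplexMeasure Φ)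
    (hK : IsTransportKernel K) (h : IndepKernel P K Φ) (n m k : Fin d → ℤ) :
    ∫⁻ ω, flow (variationKernel hΦ) (transportVariation hK) n m ω *
        variationKernel hΦ ω (cell k) ∂P =
      ∫⁻ ω, (∫⁻ x in cell n, ∫⁻ ω', transportVariation hK (ω', x) (cell m) ∂P
        ∂variationKernel hΦ ω) * variationKernel hΦ ω (cell k) ∂P := by
  obtain ⟨𝒢, h𝒢, hKm, hind⟩ := h
  have hσ : sigmaField Φ ≤ mΩ := iSup_le fun B => iSup_le fun hB => iSup_le fun hBm =>
    (hΦ.2 B hB hBm).comap_le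
  have hΦ' : @IsRandomComplexMeasure Ω (E d) (sigmaField Φ) _ _ Φ := by
    refine ⟨hΦ.1, fun B hB hBm => Measurable.mono (comap_measurable _) ?_ le_rfl⟩
    exact le_iSup_of_le B (le_iSup_of_le hB (le_iSup_of_le hBm le_rfl))
  have hℓ : Measurable[MeasurableSpace.prod 𝒢 inferInstance]
      fun p : Ω × E d => (K p.1 p.2).variation (cell m) :=
    (Measure.measurable_coe (measurableSet_cell m)).comp
      (@measurable_variation (E d) _ _ (Ω × E d) (MeasurableSpace.prod 𝒢 inferInstance)
        (fun p => K p.1 p.2) hKm)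
  have hif : @IndepFun Ω Ω Ω mΩ 𝒢 (sigmaField Φ) id id P := by
    refine (@IndepFun_iff_Indep Ω Ω Ω mΩ 𝒢 (sigmaField Φ) id id P).2 ?_
    rw [MeasurableSpace.comap_id, MeasurableSpace.comap_id]
    exact hind
  exact @lintegral_decoupled Ω Ω Ω (E d) mΩ 𝒢 (sigmaField Φ) _ P _ id id
    (measurable_id'' h𝒢) (measurable_id'' hσ) hif (@variationKernel d Ω (sigmaField Φ) Φ hΦ') _ _ hℓ
    _ _ (measurableSet_cell n) (measurableSet_cell k)

theorem tsum_flow_sq_lt_top_of_independentCondition [IsProbabilityMeasure P]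
    (hΦ : IsRandomComplexMeasure Φ)
    (hΦinv : IsInvariantMeasure Φ) (hΦsq : LocAbsSquareIntegrable P Φ) (hK : IsTransportKernel K)
    (hKinv : IsInvariantKernel K) (h : IndependentCondition P K Φ) :
    ∫⁻ ω, (∑' n, flow (variationKernel hΦ) (transportVariation hK) n 0 ω) ^ 2 ∂P < ∞ := by
  obtain ⟨⟨b, hb⟩, hind, hmom⟩ := h
  exact tsum_flow_sq_lt_top_of_decoupled (invariantUnder_variationKernel hΦ hΦinv)
    (kernelInvariantUnder_transportVariation hK hKinv)
    (hΦsq _ (isBounded_cell 0) (measurableSet_cell 0)) (fun p => hb p.1 p.2)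
    (lintegral_flow_mul_of_indepKernel hΦ hK hind) hmom

end Assembly

end Transport

end

theorem theoremt {d : ℕ} (hd : 0 < d)
    {Ω : Type*} [MeasurableSpace Ω] (P : Measure Ω) [IsProbabilityMeasure P]
    [AddAction (Transport.E d) Ω] [MeasurableVAdd₂ (Transport.E d) Ω]
    [VAddInvariantMeasure (Transport.E d) Ω P]
    (Φ : Ω → Set (Transport.E d) → ℂ) (hΦ : Transport.IsRandomComplexMeasure Φ)
    (hΦinv : Transport.IsInvariantMeasure Φ) (hΦsq : Transport.LocAbsSquareIntegrable P Φ)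
    (K : Ω → Transport.E d → ComplexMeasure (Transport.E d))
    (hK : Transport.IsTransportKernel K) (hKinv : Transport.IsInvariantKernel K)
    (hcond : Transport.GeneralCondition P K Φ ∨ Transport.IndependentCondition P K Φ) :
    (∀ᵐ ω ∂P, IsLocallyFiniteMeasure (Transport.absDestination K Φ ω)) ∧
      Transport.IsRandomComplexMeasure (Transport.destination K Φ) ∧
      Transport.LocAbsSquareIntegrable P (Transport.destination K Φ) := by
  refine Transport.destination_of_locSquareIntegrable hΦ hK
    (Transport.locSquareIntegrable_absDestination hΦ hΦinv hK hKinv ?_)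
  rcases hcond with h | h
  · exact Transport.tsum_flow_sq_lt_top_of_generalCondition hd hΦ hΦinv hK hKinv h
  · exact Transport.tsum_flow_sq_lt_top_of_independentCondition hΦ hΦinv hΦsq hK hKinv h
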